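/- Let $M$ be a smooth manifold of dimension $n\ge 1$ with cotangent bundle $T^*M$, and let $H$ be a real function, smooth on $T^*M$ without its zero section, such that $\Omega=\sum_{s=1}^n p_s\,\partial H/\partial p_s\neq 0$ at all points $(x,p)$ with $p\ne 0$ (here $x^1,\dots,x^n,p_1,\dots,p_n$ are the coordinates on $T^*M$ induced by a local chart of $M$). All systems below are considered for $p\neq 0$. A dynamical system in $T^*M$ *admits normal shift of hypersurfaces* if for every smooth hypersurface $\sigma\subset M$ with a smooth nowhere vanishing field $\mathbf n$ of normal covectors ($\langle\mathbf n\,|\,\tau\rangle=0$ for all $\tau$ tangent to $\sigma$), every $y_0\in\sigma$ and every constant $\nu_0\ne0$ there are an open neighbourhood $O$ of $y_0$ in $\sigma$ and a smooth function $\nu$ on $O$ with $\nu(y_0)=\nu_0$ which determines a normal shift of $O$. This means: the trajectories $t\mapsto(x(t,y),p(t,y))$ with initial data $x(0,y)=y$, $p(0,y)=\nu(y)\,\mathbf n(y)$, $y\in O$, exist and depend smoothly on $(t,y)$ on a common time interval $(-\varepsilon,\varepsilon)$, where the displaced hypersurfaces $\sigma_t=\{x(t,y)\}$ are again (immersed)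 hypersurfaces; and whenever a family of such trajectories, with $y$ in an open subset of $O$ and $t$ in an open interval containing $0$, is smooth in $(t,y)$, then $\langle p(t,y)\,|\,\tau\rangle=0$ for all $t$, $y$ of the family and every $\tau$ in the image of the differential of $y\mapsto x(t,y)$, i.e. all displaced hypersurfaces are perpendicular to the shift trajectories. *Connection form.* Let $\Gamma$ be any symmetric extended affine connection on $M$, with smooth components $\Gamma^k_{ij}=\Gamma^k_{ji}$ depending on $(x,p)$, $p\ne0$, which under a change of chart transform as $$\Gamma^k_{ij}=\sum_{m,a,c}\frac{\partial x^k}{\partial\tilde x^m}\frac{\partial\tilde x^a}{\partial x^i}\frac{\partial\tilde x^c}{\partial x^j}\,\tilde\Gamma^m_{ac}+\sum_m\frac{\partial x^k}{\partial\tilde x^m}\frac{\partial^2\tilde x^m}{\partial x^i\,\partial x^j}.$$ Put $\tilde\nabla^iH=\partial H/\partial p_i$, $\nabla_iH=\partial H/\partial x^i+\sum_{b,c}p_c\Gamma^c_{ib}\,\partial H/\partial p_b$, and $\nabla_tp_i=\dot p_i-\sum_{j,k}\Gamma^k_{ij}p_k\dot x^j$. Then the modified Hamiltonian dynamical system $$\dot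 x^i=\frac{\tilde\nabla^iH}{\sum_{s}p_s\tilde\nabla^sH},\qquad \nabla_tp_i=-\frac{\nabla_iH}{\sum_{s}p_s\tilde\nabla^sH}$$ is of the form $\dot x^i=V^i(x,p)$, $\nabla_tp_i=Q_i(x,p)$ with a smooth extended vector field $V$ and a smooth extended covector field $Q$ (the components are smooth functions of $(x,p)$, $p\ne0$, and transform under changes of chart like those of vectors and covectors), and it admits normal shift of hypersurfaces. *Connection-free form.* The modified Hamiltonian dynamical system $$\dot x^i=\frac{\partial H/\partial p_i}{\sum_{s}p_s\,\partial H/\partial p_s},\qquad \dot p_i=-\frac{\partial H/\partial x^i}{\sum_{s}p_s\,\partial H/\partial p_s}$$ is a smooth dynamical system of the form $\dot x^i=V^i(x,p)$, $\dot p_i=\Theta_i(x,p)$ (its right hand sides represent, in all charts, one smooth vector field on $T^*M$ without the zero section), and it admits normal shift of hypersurfaces. -/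

import Mathlib

open Set Bundle
open scoped Manifold ContDiff Topology

noncomputable section

universe u

/-- The model space `ℝⁿ`. -/
abbrev Euc (n : ℕ) : Type := EuclideanSpace ℝ (Fin n)

namespace NormalShift

variable {n : ℕ} {M : Type u} [TopologicalSpace M] [ChartedSpace (Euc n) M]

/-! ### The cotangent bundle and its local coordinates -/

/-- The cotangent bundle `T*M`: a point is a pair `q = ⟨x, p⟩` with `p` a linear functional on the
tangent space `T_x M`.  Topology and smooth structure are those of Mathlib's bundle of continuous
linear maps. -/
abbrev CotangentBundle (n : ℕ) (M : Type u) [TopologicalSpace M] [ChartedSpace (Euc n) M] :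
    Type u :=
  TotalSpace (Euc n →L[ℝ] ℝ) (fun x : M => TangentSpace (𝓡 n) x →L[ℝ] Trivial M ℝ x)

/-- The model with corners of `T*M`. -/
abbrev cotModel (n : ℕ) : ModelWithCorners ℝ (Euc n × (Euc n →L[ℝ] ℝ))
    (ModelProd (Euc n) (Euc n →L[ℝ] ℝ)) :=
  (𝓡 n).prod 𝓘(ℝ, Euc n →L[ℝ] ℝ)

/-- `φ` is a local chart of the smooth manifold `M` (a member of its maximal smooth atlas);
its components are the local coordinates `x¹, …, xⁿ`. -/
def IsChart (φ : OpenPartialHomeomorph M (Euc n)) : Prop :=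
  φ ∈ IsManifold.maximalAtlas (𝓡 n) ∞ M

/-- The coordinate vector `∂/∂xⁱ` at `x`. -/
def coordVec (φ : OpenPartialHomeomorph M (Euc n)) (x : M) (i : Fin n) : TangentSpace (𝓡 n) x :=
  (mfderiv (𝓡 n) (𝓡 n) φ x).inverse (EuclideanSpace.single i (1 : ℝ))

/-- The coordinate covector `dxⁱ` at `x`. -/
def coordCovec (φ : OpenPartialHomeomorph M (Euc n)) (x : M) (i : Fin n) :
    TangentSpace (𝓡 n) x →L[ℝ] ℝ :=
  (EuclideanSpace.proj i : Euc n →L[ℝ] ℝ).comp (mfderiv (𝓡 n) (𝓡 n) φ x)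

/-- The components `p₁, …, pₙ` of the momentum covector of a point of `T*M`. -/
def momentum (φ : OpenPartialHomeomorph M (Euc n)) (q : CotangentBundle n M) : Fin n → ℝ :=
  fun i => q.2 (coordVec φ q.proj i)

/-- The point of `T*M` with local coordinates `x¹, …, xⁿ, p₁, …, pₙ`. -/
def ofCoords (φ : OpenPartialHomeomorph M (Euc n)) (x : Euc n) (p : Fin n → ℝ) :
    CotangentBundle n M :=
  ⟨φ.symm x, ∑ i, p i • coordCovec φ (φ.symm x) i⟩

/-- Partial derivative `∂f/∂xⁱ`. -/
def dx (f : Euc n → (Fin n → ℝ) → ℝ) (i : Fin n) (x : Euc n) (p : Fin n → ℝ) : ℝ :=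
  fderiv ℝ (fun x' => f x' p) x (EuclideanSpace.single i 1)

/-- Partial derivative `∂f/∂pᵢ`. -/
def dp (f : Euc n → (Fin n → ℝ) → ℝ) (i : Fin n) (x : Euc n) (p : Fin n → ℝ) : ℝ :=
  fderiv ℝ (fun p' => f x p') p (Pi.single i 1)

/-- The Jacobi matrix `∂(ψ-coordinate i)/∂(φ-coordinate j)` at the point with `φ`-coordinates
`x`. -/
def jac (φ ψ : OpenPartialHomeomorph M (Euc n)) (x : Euc n) (i j : Fin n) : ℝ :=
  fderiv ℝ (fun z => ψ (φ.symm z)) x (EuclideanSpace.single j 1) i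

/-- The base part of the change of coordinates from `φ` to `ψ`. -/
def changeX (φ ψ : OpenPartialHomeomorph M (Euc n)) (x : Euc n) : Euc n := ψ (φ.symm x)

/-- The change of momentum components from `φ` to `ψ`: `p̃_a = Σᵢ (∂xⁱ/∂x̃ᵃ) pᵢ`. -/
def changeP (φ ψ : OpenPartialHomeomorph M (Euc n)) (x : Euc n) (p : Fin n → ℝ) : Fin n → ℝ :=
  fun a => ∑ i, jac ψ φ (changeX φ ψ x) i a * p i

/-- The coordinate domain of `T*M` without its zero section in the chart `φ`. -/
def coordDomain (φ : OpenPartialHomeomorph M (Euc n)) : Set (Euc n × (Fin n → ℝ)) :=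
  {z | z.1 ∈ φ.target ∧ z.2 ≠ 0}

/-- The part of `coordDomain φ` whose points are covered by the chart `ψ`, too. -/
def coordOverlap (φ ψ : OpenPartialHomeomorph M (Euc n)) : Set (Euc n × (Fin n → ℝ)) :=
  {z | z ∈ coordDomain φ ∧ φ.symm z.1 ∈ ψ.source}

/-! ### Extended tensor fields, extended connections -/

/-- A family of `n` functions of `x¹, …, xⁿ, p₁, …, pₙ` for every chart. -/
abbrev LocalComponents (n : ℕ) (M : Type u) [TopologicalSpace M] : Type u :=
  OpenPartialHomeomorph M (Euc n) → Euc n → (Fin n → ℝ) → (Fin n → ℝ)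

/-- The components depend smoothly on `x` and `p`, for `p ≠ 0`. -/
def SmoothComponents (V : LocalComponents n M) : Prop :=
  ∀ φ : OpenPartialHomeomorph M (Euc n), IsChart φ →
    ContDiffOn ℝ ∞ (fun z : Euc n × (Fin n → ℝ) => V φ z.1 z.2) (coordDomain φ)

/-- `Vⁱ(x, p)` are the components of a smooth extended vector field (`p ≠ 0`). -/
def IsExtendedVectorField (V : LocalComponents n M) : Prop :=
  SmoothComponents V ∧
  ∀ φ ψ : OpenPartialHomeomorph M (Euc n), IsChart φ → IsChart ψ →
    ∀ x p, (x, p) ∈ coordOverlap φ ψ → ∀ i,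
      V ψ (changeX φ ψ x) (changeP φ ψ x p) i = ∑ j, jac φ ψ x i j * V φ x p j

/-- `Qᵢ(x, p)` are the components of a smooth extended covector field (`p ≠ 0`). -/
def IsExtendedCovectorField (Q : LocalComponents n M) : Prop :=
  SmoothComponents Q ∧
  ∀ φ ψ : OpenPartialHomeomorph M (Euc n), IsChart φ → IsChart ψ →
    ∀ x p, (x, p) ∈ coordOverlap φ ψ → ∀ i,
      Q ψ (changeX φ ψ x) (changeP φ ψ x p) i = ∑ j, jac ψ φ (changeX φ ψ x) j i * Q φ x p j

/-- A symmetric extended affine connection in `p`-representation (`p ≠ 0`): components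
`Γᵏᵢⱼ(x, p)` in every chart, written `comp φ x p k i j`, smooth, symmetric in `i, j`, with
`Γᵏᵢⱼ = Σ Sᵏₘ Tᵃᵢ Tᶜⱼ Γ̃ᵐ_{ac} + Σ Sᵏₘ ∂Tᵐᵢ/∂xʲ`, where `S = ∂x/∂x̃` and `T = ∂x̃/∂x`. -/
structure SymmetricExtendedConnection (n : ℕ) (M : Type u) [TopologicalSpace M]
    [ChartedSpace (Euc n) M] where
  comp : OpenPartialHomeomorph M (Euc n) → Euc n → (Fin n → ℝ) → Fin n → Fin n → Fin n → ℝ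
  smooth : ∀ φ : OpenPartialHomeomorph M (Euc n), IsChart φ → ∀ k i j,
    ContDiffOn ℝ ∞ (fun z : Euc n × (Fin n → ℝ) => comp φ z.1 z.2 k i j) (coordDomain φ)
  symmetric : ∀ φ : OpenPartialHomeomorph M (Euc n), IsChart φ →
    ∀ x p, (x, p) ∈ coordDomain φ → ∀ k i j, comp φ x p k i j = comp φ x p k j i
  transform : ∀ φ ψ : OpenPartialHomeomorph M (Euc n), IsChart φ → IsChart ψ →
    ∀ x p, (x, p) ∈ coordOverlap φ ψ → ∀ k i j,
      comp φ x p k i j =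
        (∑ m, ∑ a, ∑ c, jac ψ φ (changeX φ ψ x) k m * jac φ ψ x a i * jac φ ψ x c j *
          comp ψ (changeX φ ψ x) (changeP φ ψ x p) m a c) +
        ∑ m, jac ψ φ (changeX φ ψ x) k m *
          fderiv ℝ (fun z => jac φ ψ z m i) x (EuclideanSpace.single j 1)

/-- Horizontal covariant derivative of an extended scalar field,
`∇ₘ f = ∂f/∂xᵐ + Σ_b Σ_c p_c Γᶜ_{mb} ∂f/∂p_b` (the one for which `∇ᵢ pⱼ = 0`). -/
def covDeriv (Γ : SymmetricExtendedConnection n M) (φ : OpenPartialHomeomorph M (Euc n))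
    (f : Euc n → (Fin n → ℝ) → ℝ) (m : Fin n) (x : Euc n) (p : Fin n → ℝ) : ℝ :=
  dx f m x p + ∑ b, ∑ c, p c * Γ.comp φ x p c m b * dp f b x p

/-! ### Newtonian dynamical systems in the cotangent bundle -/

/-- `V`, `Θ` are the components of a smooth dynamical system `ẋⁱ = Vⁱ(x, p)`, `ṗᵢ = Θᵢ(x, p)` in
`T*M` (`p ≠ 0`): in different charts they represent the same vector field on `T*M`. -/
def IsNewtonianSystem (V Θ : LocalComponents n M) : Prop :=
  IsExtendedVectorField V ∧ SmoothComponents Θ ∧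
  ∀ φ ψ : OpenPartialHomeomorph M (Euc n), IsChart φ → IsChart ψ →
    ∀ x p, (x, p) ∈ coordOverlap φ ψ →
      Θ ψ (changeX φ ψ x) (changeP φ ψ x p) =
        fderiv ℝ (fun z : Euc n × (Fin n → ℝ) => changeP φ ψ z.1 z.2) (x, p)
          (WithLp.toLp 2 (V φ x p), Θ φ x p)

/-- `γ` is, on the open set `J` of times, a trajectory (with nonzero momentum) of the system
`ẋⁱ = Vⁱ(x, p)`, `ṗᵢ = Θᵢ(x, p)`. -/
def IsTrajectory [IsManifold (𝓡 n) ∞ M] (V Θ : LocalComponents n M) (J : Set ℝ) (γ : ℝ → CotangentBundle n M) : Prop :=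
  ContinuousOn γ J ∧ ∀ t ∈ J, (γ t).2 ≠ 0 ∧
    ∀ φ : OpenPartialHomeomorph M (Euc n), IsChart φ → (γ t).proj ∈ φ.source → ∀ i,
      HasDerivAt (fun s => φ (γ s).proj i) (V φ (φ (γ t).proj) (momentum φ (γ t)) i) t ∧
      HasDerivAt (fun s => momentum φ (γ s) i) (Θ φ (φ (γ t).proj) (momentum φ (γ t)) i) t

/-- `γ` is, on the open set `J` of times, a trajectory (with nonzero momentum) of the system
`ẋⁱ = Vⁱ(x, p)`, `∇ₜpᵢ = Qᵢ(x, p)`, where `∇ₜpᵢ = ṗᵢ - Σⱼ Σₖ Γᵏᵢⱼ pₖ ẋʲ`. -/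
def IsCovTrajectory [IsManifold (𝓡 n) ∞ M] (Γ : SymmetricExtendedConnection n M) (V Q : LocalComponents n M)
    (J : Set ℝ) (γ : ℝ → CotangentBundle n M) : Prop :=
  ContinuousOn γ J ∧ ∀ t ∈ J, (γ t).2 ≠ 0 ∧
    ∀ φ : OpenPartialHomeomorph M (Euc n), IsChart φ → (γ t).proj ∈ φ.source →
      ∃ x' p' : Fin n → ℝ,
        (∀ i, HasDerivAt (fun s => φ (γ s).proj i) (x' i) t) ∧
        (∀ i, HasDerivAt (fun s => momentum φ (γ s) i) (p' i) t) ∧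
        (∀ i, x' i = V φ (φ (γ t).proj) (momentum φ (γ t)) i) ∧
        ∀ i, p' i - (∑ j, ∑ k, Γ.comp φ (φ (γ t).proj) (momentum φ (γ t)) k i j *
            momentum φ (γ t) k * x' j) =
          Q φ (φ (γ t).proj) (momentum φ (γ t)) i

/-! ### Normal shift of hypersurfaces -/

section Shift

variable {d : ℕ} {N : Type u} [TopologicalSpace N] [ChartedSpace (Euc (d + 1)) N]
  {S : Type u} [TopologicalSpace S] [ChartedSpace (Euc d) S]

/-- `ι : S → N` presents the `d`-dimensional manifold `S` as a smooth hypersurface of the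
`(d + 1)`-dimensional manifold `N`.  (Immersed hypersurfaces are admitted; inclusions of embedded
hypersurfaces are a special case.) -/
def IsHypersurface (ι : S → N) : Prop :=
  ContMDiff (𝓡 d) (𝓡 (d + 1)) ∞ ι ∧
    ∀ y, Function.Injective (mfderiv (𝓡 d) (𝓡 (d + 1)) ι y)

variable [IsManifold (𝓡 (d + 1)) ∞ N]

/-- `nu` is a smooth nowhere vanishing field of normal covectors of the hypersurface `ι`. -/
def IsNormalCovectorField (ι : S → N)
    (nu : ∀ y, TangentSpace (𝓡 (d + 1)) (ι y) →L[ℝ] ℝ) : Prop :=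
  ContMDiff (𝓡 d) (cotModel (d + 1)) ∞ (fun y => (⟨ι y, nu y⟩ : CotangentBundle (d + 1) N)) ∧
    ∀ y, nu y ≠ 0 ∧ ∀ τ : TangentSpace (𝓡 d) y, nu y (mfderiv (𝓡 d) (𝓡 (d + 1)) ι y τ) = 0

/-- `q t y` (`t ∈ J`, `y ∈ O`) is a shift of the part `O` of the hypersurface `ι` along the
trajectories of a dynamical system in the cotangent bundle (given by its trajectories), with the
initial data `x = ι y`, `p = ν(y) • nu y` at `t = 0`. -/
structure IsShift (Traj : Set ℝ → (ℝ → CotangentBundle (d + 1) N) → Prop) (ι : S → N)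
    (nu : ∀ y, TangentSpace (𝓡 (d + 1)) (ι y) →L[ℝ] ℝ) (ν : S → ℝ)
    (J : Set ℝ) (O : Set S) (q : ℝ → S → CotangentBundle (d + 1) N) : Prop where
  isOpen_time : IsOpen J
  interval_time : J.OrdConnected
  zero_mem : (0 : ℝ) ∈ J
  isOpen_part : IsOpen O
  smooth : ContMDiffOn (𝓘(ℝ, ℝ).prod (𝓡 d)) (cotModel (d + 1)) ∞
    (fun z : ℝ × S => q z.1 z.2) (J ×ˢ O)
  initial : ∀ y ∈ O, q 0 y = ⟨ι y, ν y • nu y⟩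
  trajectory : ∀ y ∈ O, Traj J (fun t => q t y)

/-- The displacement map `y ↦ x(t, y)` of a family of curves in `T*N`. -/
def displacement (q : ℝ → S → CotangentBundle (d + 1) N) (t : ℝ) : S → N := fun y => (q t y).proj

/-- The displaced hypersurfaces `y ↦ x(t, y)` are perpendicular to the shift trajectories:
`⟨p | τ⟩ = 0` for the momentum covector `p` of the trajectory and all vectors `τ` tangent to the
displaced hypersurface. -/
def ShiftIsNormal (J : Set ℝ) (O : Set S) (q : ℝ → S → CotangentBundle (d + 1) N) : Prop :=
  ∀ t ∈ J, ∀ y ∈ O, ∀ τ : TangentSpace (𝓡 d) y,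
    (q t y).2 (mfderiv (𝓡 d) (𝓡 (d + 1)) (displacement q t) y τ) = 0

/-- The initial data `x = ι y`, `p = ν(y) • nu y` determine a normal shift of the part `O` of the
hypersurface: for small times the shift exists and its displaced hypersurfaces are again
hypersurfaces, and any shift with these initial data (on any part of `O`, for any time interval on
which it is defined) is normal. -/
def DeterminesNormalShift (Traj : Set ℝ → (ℝ → CotangentBundle (d + 1) N) → Prop) (ι : S → N)
    (nu : ∀ y, TangentSpace (𝓡 (d + 1)) (ι y) →L[ℝ] ℝ) (ν : S → ℝ) (O : Set S) : Prop :=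
  (∃ ε : ℝ, 0 < ε ∧ ∃ q : ℝ → S → CotangentBundle (d + 1) N,
    IsShift Traj ι nu ν (Ioo (-ε) ε) O q ∧
    ∀ t ∈ Ioo (-ε) ε, ∀ y ∈ O,
      Function.Injective (mfderiv (𝓡 d) (𝓡 (d + 1)) (displacement q t) y)) ∧
  ∀ (J : Set ℝ) (O' : Set S) (q : ℝ → S → CotangentBundle (d + 1) N), O' ⊆ O →
    IsShift Traj ι nu ν J O' q → ShiftIsNormal J O' q

end Shift

/-- Strong normality condition (the system *admits normal shift of hypersurfaces*): for every
hypersurface with normal covector field `nu`, every point `y₀` of it and every `ν₀ ≠ 0`, some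
smooth function `ν` on a neighbourhood of `y₀` with `ν(y₀) = ν₀` determines a normal shift. -/
def AdmitsNormalShift {d : ℕ} {N : Type u} [TopologicalSpace N] [ChartedSpace (Euc (d + 1)) N]
    [IsManifold (𝓡 (d + 1)) ∞ N]
    (Traj : Set ℝ → (ℝ → CotangentBundle (d + 1) N) → Prop) : Prop :=
  ∀ (S : Type u) [TopologicalSpace S] [ChartedSpace (Euc d) S] [IsManifold (𝓡 d) ∞ S]
    (ι : S → N) (nu : ∀ y, TangentSpace (𝓡 (d + 1)) (ι y) →L[ℝ] ℝ),
    IsHypersurface (d := d) ι → IsNormalCovectorField (d := d) ι nu →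
    ∀ (y₀ : S) (ν₀ : ℝ), ν₀ ≠ 0 →
      ∃ (O : Set S) (ν : S → ℝ), IsOpen O ∧ y₀ ∈ O ∧ ContMDiffOn (𝓡 d) 𝓘(ℝ, ℝ) ∞ ν O ∧
        ν y₀ = ν₀ ∧ DeterminesNormalShift (d := d) Traj ι nu ν O

/-! ### The modified Hamiltonian dynamical system -/

section Hamilton

variable (H : CotangentBundle n M → ℝ)

/-- The Hamilton function in local coordinates, `H(x¹, …, xⁿ, p₁, …, pₙ)`. -/
def localH (φ : OpenPartialHomeomorph M (Euc n)) (x : Euc n) (p : Fin n → ℝ) : ℝ :=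
  H (ofCoords φ x p)

/-- The denominator `Σₛ pₛ ∂H/∂pₛ`. -/
def Omega (φ : OpenPartialHomeomorph M (Euc n)) (x : Euc n) (p : Fin n → ℝ) : ℝ :=
  ∑ s, p s * dp (localH H φ) s x p

/-- `Vⁱ = (∂H/∂pᵢ) / Ω`. -/
def modV : LocalComponents n M := fun φ x p i => dp (localH H φ) i x p / Omega H φ x p

/-- `Θᵢ = -(∂H/∂xⁱ) / Ω`. -/
def modTheta : LocalComponents n M := fun φ x p i => -(dx (localH H φ) i x p / Omega H φ x p)

/-- `Qᵢ = -(∇ᵢH) / Ω`. -/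
def modQ (Γ : SymmetricExtendedConnection n M) : LocalComponents n M :=
  fun φ x p i => -(covDeriv Γ φ (localH H φ) i x p / Omega H φ x p)

end Hamilton

end NormalShift

end

/-! Along a trajectory of the modified system `H` is conserved, since the field is the Hamiltonian
field divided by `Ω`; and `⟨p | ẋ⟩ = 1`, which is what the division by `Ω` achieves. Consider a
family `x(t, s)`, `p(t, s)` of trajectories with variation `τ = ∂x/∂s`. As `⟨p | ∂ẋ/∂s⟩ = ∂⟨p |
ẋ⟩/∂s - ⟨∂p/∂s | ẋ⟩` and the first term vanishes, `d/dt ⟨p | τ⟩ = ⟨ṗ | τ⟩ - ⟨∂p/∂s | ẋ⟩ = -Ω⁻¹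
∂H/∂s`. If the initial data have constant energy, then by conservation so has the whole family.
Hence `⟨p | τ⟩` does not depend on `t`, and it is `0` at `t = 0` because the initial momentum is
normal to the hypersurface (`hasDerivAt_momentum_variation`, `hamiltonian_eq`, `shiftIsNormal`).

It remains to choose `ν` with `H(y, ν(y) n(y))` constant near `y₀`. The derivative of `H` along the
ray `r ↦ r n` is `Ω / r ≠ 0`, so the implicit function theorem gives a smooth `ν` with the
prescribed value at `y₀` (`exists_energy_scaling`). The shift itself comes from a smooth local flow
in one chart. Its displacement maps are immersions for small times because injectivity of the
differential is an open condition (`exists_normal_shift`).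

The flow is obtained from the implicit function theorem in a space of continuous curves, where the
Picard equation depends smoothly on time, initial point and curve (`exists_smooth_local_flow`).

Independence of charts is the chain rule: second derivatives of the coordinate change produce the
same terms in `∂H/∂x`, in the transformed `ṗ` and in the contraction of `p` with the connection.
That contraction enters `∇ₜp` and `∇H` alike, so both forms of the system have the same trajectories
(`modQ_eq`, `isCovTrajectory_eq_isTrajectory`). -/

noncomputable section

universe u

/-! ### Smoothness of implicit functions on a neighbourhood -/

section Implicit

variable {E₁ : Type*} [NormedAddCommGroup E₁] [NormedSpace ℝ E₁] [CompleteSpace E₁]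
  {E₂ : Type*} [NormedAddCommGroup E₂] [NormedSpace ℝ E₂] [CompleteSpace E₂]
  {F : Type*} [NormedAddCommGroup F] [NormedSpace ℝ F] [CompleteSpace F]

/-- For `n = ∞`, smoothness at one point does not by itself spread to a neighbourhood. At a nearby
`x` the partial derivative is still invertible, so the theorem applies again at `(x, ψ x)`; local
uniqueness identifies the new implicit function with `ψ`. -/
theorem ContDiffAt.eventually_contDiffAt_implicitFunction {u : E₁ × E₂} {f : E₁ × E₂ → F}
    {n : ℕ∞ω} (hf : ∀ᶠ v in 𝓝 u, ContDiffAt ℝ n f v) (pn : n ≠ 0)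
    (if₂ : (fderiv ℝ f u ∘L .inr ℝ E₁ E₂).IsInvertible) :
    ∀ᶠ x in 𝓝 u.1, ContDiffAt ℝ n (hf.self_of_nhds.implicitFunction pn if₂) x := by
  set ψ := hf.self_of_nhds.implicitFunction pn if₂ with hψ
  have hψu : ψ u.1 = u.2 := hf.self_of_nhds.implicitFunction_apply_self pn if₂
  have h1 : (1 : ℕ∞ω) ≤ n := ENat.one_le_iff_ne_zero_withTop.2 pn
  have hcont : ∀ᶠ x in 𝓝 u.1, ContinuousAt ψ x := by
    have := (hf.self_of_nhds.contDiffAt_implicitFunction pn if₂).of_le h1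
    filter_upwards [this.eventually (by simp)] with x hx using hx.continuousAt
  have hinv : ∀ᶠ v in 𝓝 u, (fderiv ℝ f v ∘L .inr ℝ E₁ E₂).IsInvertible := by
    have hc : ContinuousAt (fun v => fderiv ℝ f v ∘L .inr ℝ E₁ E₂) u := by
      have h : ContinuousAt (fderiv ℝ f) u :=
        ((hf.self_of_nhds.of_le h1).fderiv_right (m := 0) (by simp)).continuousAt
      exact h.clm_comp continuousAt_const
    obtain ⟨e, he⟩ := if₂
    have hn := e.nhds
    rw [he] at hn
    filter_upwards [hc.preimage_mem_nhds hn] with v ⟨e, he⟩ using ⟨e, he⟩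
  have hpair : Filter.Tendsto (fun x => (x, ψ x)) (𝓝 u.1) (𝓝 u) := by
    have : ContinuousAt (fun x => (x, ψ x)) u.1 := continuousAt_id.prodMk hcont.self_of_nhds
    simpa [ContinuousAt, hψu] using this
  have heq := (hf.self_of_nhds.eventually_apply_implicitFunction pn if₂).eventually_nhds
  filter_upwards [hcont, heq, hpair.eventually hf, hpair.eventually hinv] with x hx hxe hxf hxi
  have h2 := hxf.eventually_apply_eq_iff_implicitFunction pn hxi
  have h3 := (continuousAt_id.prodMk hx).eventually h2
  refine (hxf.contDiffAt_implicitFunction pn hxi).congr_of_eventuallyEq ?_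
  filter_upwards [h3, hxe] with z hz hze
  exact (hz.1 (hze.trans hxe.self_of_nhds.symm)).symm

end Implicit

/-! ### The composition operator on spaces of continuous functions -/

section Omega

namespace ContinuousMap

variable (K : Type*) [TopologicalSpace K] [CompactSpace K]
  (E : Type*) [NormedAddCommGroup E] [NormedSpace ℝ E]
  (F : Type*) [NormedAddCommGroup F] [NormedSpace ℝ F]

set_option synthInstance.maxHeartbeats 200000 in
/-- Pointwise application of a family of continuous linear maps. -/
def pointwiseApplyL : C(K, E →L[ℝ] F) →L[ℝ] C(K, E) →L[ℝ] C(K, F) :=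
  LinearMap.mkContinuous₂
    (LinearMap.mk₂ ℝ (fun (A : C(K, E →L[ℝ] F)) (h : C(K, E)) => (⟨fun k => A k (h k), by fun_prop⟩ : C(K, F)))
      (fun A B h => by ext; simp) (fun c A h => by ext; simp)
      (fun A h h' => by ext; simp) (fun c A h => by ext; simp)) 1 (by
    intro A h
    rw [one_mul]
    refine (ContinuousMap.norm_le _ (by positivity)).2 fun k => ?_
    exact ((A k).le_opNorm _).trans (by gcongr <;> apply ContinuousMap.norm_coe_le_norm))

variable {K E F}

@[simp] theorem pointwiseApplyL_apply (A : C(K, E →L[ℝ] F)) (h : C(K, E)) (k : K) :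
    pointwiseApplyL K E F A h k = A k (h k) := rfl

set_option synthInstance.maxHeartbeats 200000 in
-- The range of `y` is compact, so `f'` is uniformly continuous near it. The mean value inequality
-- on balls of one radius `δ` then bounds the remainder uniformly in `k`.
theorem hasFDerivAt_comp_left {f : C(E, F)} {f' : C(E, E →L[ℝ] F)}
    (hf : ∀ x, HasFDerivAt f (f' x) x) (y : C(K, E)) :
    HasFDerivAt (fun y : C(K, E) => f.comp y) (pointwiseApplyL K E F (f'.comp y)) y := by
  rw [hasFDerivAt_iff_isLittleO_nhds_zero, Asymptotics.isLittleO_iff]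
  intro c hc
  have hK : IsCompact (range y) := isCompact_range y.continuous
  have hu := hK.uniformContinuousAt_of_continuousAt f' (fun a _ => f'.continuous.continuousAt)
    (Metric.dist_mem_uniformity hc)
  obtain ⟨δ, hδ, hδ'⟩ := Metric.mem_uniformity_dist.1 hu
  filter_upwards [Metric.ball_mem_nhds (0 : C(K, E)) hδ] with h hh
  have hh : ‖h‖ < δ := by simpa using hh
  refine (ContinuousMap.norm_le _ (by positivity)).2 fun k => ?_
  have hk : ‖h k‖ ≤ ‖h‖ := h.norm_coe_le_norm k
  have key := (convex_ball (y k) δ).norm_image_sub_le_of_norm_hasFDerivWithin_le' (f := f)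
    (f' := f') (φ := f' (y k)) (C := c) (x := y k) (y := y k + h k)
    (fun x _ => (hf x).hasFDerivWithinAt) ?_ (by simpa using hδ)
    (by simpa using hk.trans_lt hh)
  · simp only [add_sub_cancel_left] at key
    simpa using key.trans (by gcongr)
  · intro x hx
    have := hδ' (a := y k) (b := x) (by simpa [dist_comm] using hx) (mem_range_self k)
    rw [← dist_eq_norm, dist_comm]
    exact this.le

set_option synthInstance.maxHeartbeats 200000 in
-- The derivative is the composition operator of `f'` followed by the bounded linear map
-- `pointwiseApplyL`, which allows induction on the order. The target changes from `F` to `E →L[ℝ]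
-- F` in each step, hence `F` is quantified inside the induction and lies in the universe of `E`.
theorem contDiff_comp_left_nat {K : Type*} [TopologicalSpace K] [CompactSpace K]
    {E : Type u} [NormedAddCommGroup E] [NormedSpace ℝ E] (n : ℕ) :
    ∀ {F : Type u} [NormedAddCommGroup F] [NormedSpace ℝ F] {f : C(E, F)},
      ContDiff ℝ n f → ContDiff ℝ n (fun y : C(K, E) => f.comp y) := by
  induction n with
  | zero =>
    intro F _ _ f _
    exact contDiff_zero.2 (ContinuousMap.continuous_postcomp f)
  | succ n ih =>
    intro F _ _ f hf
    have hf' := contDiff_succ_iff_fderiv.1 (show ContDiff ℝ ((n : ℕ∞ω) + 1) f by exact_mod_cast hf)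
    have hc := hf'.2.2.continuous
    have hd := hasFDerivAt_comp_left (K := K) (f := f) (f' := ⟨_, hc⟩)
      (fun x => (hf'.1 x).hasFDerivAt)
    push_cast
    refine contDiff_succ_iff_fderiv.2 ⟨fun y => (hd y).differentiableAt, by simp, ?_⟩
    rw [show fderiv ℝ (fun y : C(K, E) => f.comp y) = _ from funext fun y => (hd y).fderiv]
    exact (pointwiseApplyL K E F).contDiff.comp (ih (f := ⟨_, hc⟩) hf'.2.2)

theorem contDiff_comp_left {K : Type*} [TopologicalSpace K] [CompactSpace K]
    {E F : Type u} [NormedAddCommGroup E] [NormedSpace ℝ E] [NormedAddCommGroup F]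
    [NormedSpace ℝ F] {f : C(E, F)} (hf : ContDiff ℝ ∞ f) :
    ContDiff ℝ ∞ (fun y : C(K, E) => f.comp y) :=
  contDiff_infty.2 fun n => contDiff_comp_left_nat n (contDiff_infty.1 hf n)

end ContinuousMap

end Omega

/-! ### Smooth local flows -/

section Flow

variable {Z : Type u} [NormedAddCommGroup Z] [NormedSpace ℝ Z]

/-- The primitive vanishing at `0`, as an operator on continuous functions on `[-1, 1]`. -/
def primitiveL (Z : Type u) [NormedAddCommGroup Z] [NormedSpace ℝ Z] :
    C(Icc (-1 : ℝ) 1, Z) →L[ℝ] C(Icc (-1 : ℝ) 1, Z) :=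
  LinearMap.mkContinuous
    { toFun := fun y => (⟨fun s => ∫ r in (0 : ℝ)..s, IccExtend (by norm_num) y r, by
          have h : Continuous (IccExtend (show (-1 : ℝ) ≤ 1 by norm_num) y) :=
            y.continuous.Icc_extend'
          exact (intervalIntegral.continuous_primitive (fun a b => h.intervalIntegrable a b)
            0).comp continuous_subtype_val⟩ : C(Icc (-1 : ℝ) 1, Z))
      map_add' := fun y w => by
        ext s
        have hy : Continuous (IccExtend (show (-1 : ℝ) ≤ 1 by norm_num) y) :=
          y.continuous.Icc_extend'
        have hw : Continuous (IccExtend (show (-1 : ℝ) ≤ 1 by norm_num) w) :=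
          w.continuous.Icc_extend'
        exact intervalIntegral.integral_add (hy.intervalIntegrable 0 s)
          (hw.intervalIntegrable 0 s)
      map_smul' := fun c y => by
        ext s
        exact intervalIntegral.integral_smul c _ } 1 (by
    intro y
    refine (ContinuousMap.norm_le _ (by positivity)).2 fun s => ?_
    have h := intervalIntegral.norm_integral_le_of_norm_le_const (a := 0) (b := (s : ℝ))
      (f := IccExtend (show (-1 : ℝ) ≤ 1 by norm_num) y) (C := ‖y‖)
      (fun r _ => y.norm_coe_le_norm _)
    have hs : |(s : ℝ) - 0| ≤ 1 := by
      rw [sub_zero]; exact abs_le.2 s.2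
    refine h.trans ?_
    rw [one_mul]
    exact mul_le_of_le_one_right (norm_nonneg _) hs)

theorem HasFDerivAt.fderiv_comp_inr {E₁ E₂ F : Type*} [NormedAddCommGroup E₁] [NormedSpace ℝ E₁]
    [NormedAddCommGroup E₂] [NormedSpace ℝ E₂] [NormedAddCommGroup F] [NormedSpace ℝ F]
    {f : E₁ × E₂ → F} {x : E₁} {y : E₂} {L : E₂ →L[ℝ] F}
    (h : HasFDerivAt (fun y' => f (x, y')) L y) (hf : DifferentiableAt ℝ f (x, y)) :
    fderiv ℝ f (x, y) ∘L .inr ℝ E₁ E₂ = L :=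
  (HasFDerivAt.comp y (g := f) hf.hasFDerivAt
    ((hasFDerivAt_const x y).prodMk (hasFDerivAt_id y))).unique h |> fun h => by
      rw [← h]; ext v; simp

variable [CompleteSpace Z]

set_option maxHeartbeats 1000000 in
-- With time rescaled to `[-1, 1]`, the Picard equation `y(s) = z + t ∫₀ˢ X(y)` is `G((t, z), y) =
-- 0` for a smooth `G` on a Banach space. At `t = 0` its partial derivative in `y` is the identity,
-- so `y = ψ(t, z)` is smooth in `(t, z)`, and `F(t, z) = ψ(t, z)(1)` is the flow.
theorem exists_smooth_local_flow {X : Z → Z} (hX : ContDiff ℝ ∞ X) (z₀ : Z) :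
    ∃ ε : ℝ, 0 < ε ∧ ∃ W : Set Z, IsOpen W ∧ z₀ ∈ W ∧ ∃ F : ℝ × Z → Z,
      ContDiffOn ℝ ∞ F (Ioo (-ε) ε ×ˢ W) ∧ (∀ z ∈ W, F (0, z) = z) ∧
      ∀ z ∈ W, ∀ t ∈ Ioo (-ε) ε, HasDerivAt (fun τ => F (τ, z)) (X (F (t, z))) t := by
  set I := Icc (-1 : ℝ) 1
  have hI : (-1 : ℝ) ≤ 1 := by norm_num
  let Xc : C(Z, Z) := ⟨X, hX.continuous⟩
  let cst : Z →L[ℝ] C(I, Z) := LinearMap.mkContinuous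
    { toFun := fun z => ContinuousMap.const I z, map_add' := fun _ _ => rfl,
      map_smul' := fun _ _ => rfl } 1 (fun z => by
        rw [one_mul]; exact (ContinuousMap.norm_le _ (norm_nonneg _)).2 fun s => le_rfl)
  have hcst : ∀ z s, cst z s = z := fun _ _ => rfl
  let G : (ℝ × Z) × C(I, Z) → C(I, Z) := fun v =>
    v.2 - cst v.1.2 - v.1.1 • primitiveL Z (Xc.comp v.2)
  have hG : ContDiff ℝ ∞ G := by
    have h1 : ContDiff ℝ ∞ (fun y : C(I, Z) => Xc.comp y) := ContinuousMap.contDiff_comp_left hX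
    have h2 : ContDiff ℝ ∞ (fun v : (ℝ × Z) × C(I, Z) => primitiveL Z (Xc.comp v.2)) :=
      (primitiveL Z).contDiff.comp (h1.comp contDiff_snd)
    exact (contDiff_snd.sub (cst.contDiff.comp (contDiff_snd.comp contDiff_fst))).sub
      ((contDiff_fst.comp contDiff_fst).smul h2)
  let u : (ℝ × Z) × C(I, Z) := ((0, z₀), cst z₀)
  have hGu : G u = 0 := by simp [G, u]
  have hd : HasFDerivAt (fun y => G ((0, z₀), y)) (ContinuousLinearMap.id ℝ C(I, Z)) (cst z₀) := by
    have : (fun y => G ((0, z₀), y)) = fun y => y - cst z₀ := by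
      funext y; simp [G]
    rw [this]
    exact (hasFDerivAt_id _).sub_const _
  have if₂ : (fderiv ℝ G u ∘L .inr ℝ (ℝ × Z) C(I, Z)).IsInvertible := by
    rw [hd.fderiv_comp_inr (hG.differentiable (by simp)).differentiableAt]
    exact ⟨ContinuousLinearEquiv.refl ℝ _, rfl⟩
  have hev : ∀ᶠ v in 𝓝 u, ContDiffAt ℝ ∞ G v := Filter.Eventually.of_forall fun v => hG.contDiffAt
  have hsm := ContDiffAt.eventually_contDiffAt_implicitFunction hev (by simp) if₂
  have heq := hev.self_of_nhds.eventually_apply_eq_iff_implicitFunction (by simp) if₂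
  have hmem := hev.self_of_nhds.eventually_apply_implicitFunction (by simp) if₂
  have hself := hev.self_of_nhds.implicitFunction_apply_self (by simp) if₂
  set ψ := hev.self_of_nhds.implicitFunction (by simp) if₂
  rw [hGu] at heq hmem
  have hψc : ContinuousAt ψ (0, z₀) := hsm.self_of_nhds.continuousAt
  -- neighbourhoods
  obtain ⟨U, hU, δ, hδ, hUδ⟩ : ∃ U ∈ 𝓝 ((0 : ℝ), z₀), ∃ δ > 0, ∀ a ∈ U, ∀ y : C(I, Z),
      dist y (cst z₀) < δ → (G (a, y) = 0 ↔ ψ a = y) := by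
    obtain ⟨U, hU, V, hV, hUV⟩ := mem_nhds_prod_iff.1 heq
    obtain ⟨δ, hδ, hV⟩ := Metric.mem_nhds_iff.1 hV
    exact ⟨U, hU, δ, hδ, fun a ha y hy => hUV (mk_mem_prod ha (hV hy))⟩
  have hball : ∀ᶠ a in 𝓝 ((0 : ℝ), z₀), dist (ψ a) (cst z₀) < δ := by
    have := hψc.eventually (Metric.ball_mem_nhds _ hδ)
    rw [hself] at this
    exact this
  have hall := (hsm.and (hmem.and hball)).and hU
  obtain ⟨T, hT, W, hW, hTW⟩ := mem_nhds_prod_iff.1 hall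
  obtain ⟨ε, hε, hTε⟩ := Metric.mem_nhds_iff.1 hT
  obtain ⟨W', hW'W, hW', hzW'⟩ := mem_nhds_iff.1 hW
  have hIoo : ∀ t ∈ Ioo (-ε) ε, t ∈ T := fun t ht => hTε (by
    simpa [Real.dist_eq, abs_lt] using ht)
  have H : ∀ t ∈ Ioo (-ε) ε, ∀ z ∈ W', ContDiffAt ℝ ∞ ψ (t, z) ∧ G ((t, z), ψ (t, z)) = 0 ∧
      dist (ψ (t, z)) (cst z₀) < δ ∧ (t, z) ∈ U := fun t ht z hz => by
    have := hTW (mk_mem_prod (hIoo t ht) (hW'W hz))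
    exact ⟨this.1.1, this.1.2.1, this.1.2.2, this.2⟩
  have hint : ∀ t ∈ Ioo (-ε) ε, ∀ z ∈ W', ∀ s : I, ψ (t, z) s =
      z + t • ∫ r in (0 : ℝ)..s, X (IccExtend hI (ψ (t, z)) r) := fun t ht z hz s => by
    have := congrArg (fun y : C(I, Z) => y s) (H t ht z hz).2.1
    simp only [G, ContinuousMap.sub_apply,
      ContinuousMap.zero_apply, sub_sub, sub_eq_zero] at this
    exact this
  have hone : (1 : ℝ) ∈ I := by simp [I]
  have hzero : (0 : ℝ) ∈ I := by simp [I]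
  -- rescaling of time
  have hscale : ∀ t ∈ Ioo (-ε) ε, ∀ z ∈ W', ∀ s : I, ψ (t * s, z) ⟨1, hone⟩ = ψ (t, z) s := by
    intro t ht z hz s
    have hts : t * s ∈ Ioo (-ε) ε := by
      refine abs_lt.1 ?_
      rw [abs_mul]
      exact (mul_le_of_le_one_right (abs_nonneg _) (abs_le.2 s.2)).trans_lt (abs_lt.2 ht)
    have hmul : ∀ r : I, (s : ℝ) * r ∈ I := fun r => by
      refine abs_le.1 ?_
      rw [abs_mul]
      exact mul_le_one₀ (abs_le.2 s.2) (abs_nonneg _) (abs_le.2 r.2)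
    let w : C(I, Z) := ⟨fun r => ψ (t, z) ⟨s * r, hmul r⟩, by fun_prop⟩
    have hw : ψ (t * s, z) = w := by
      refine (hUδ _ (H _ hts z hz).2.2.2 w ?_).1 ?_
      · refine lt_of_le_of_lt ?_ (H t ht z hz).2.2.1
        exact (ContinuousMap.dist_le dist_nonneg).2 fun r =>
          ContinuousMap.dist_apply_le_dist (f := ψ (t, z)) (g := cst z₀) ⟨s * r, hmul r⟩
      · ext r
        simp only [G, ContinuousMap.sub_apply,
          ContinuousMap.zero_apply, sub_sub, sub_eq_zero]
        change ψ (t, z) ⟨s * r, hmul r⟩ = _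
        rw [hint t ht z hz, mul_smul]
        congr 2
        have hc : ∀ q ∈ uIcc (0 : ℝ) r, IccExtend hI (Xc.comp w) q =
            X (IccExtend hI (ψ (t, z)) (s * q)) := by
          intro q hq
          have hqI : q ∈ I := (ordConnected_Icc.uIcc_subset hzero r.2) hq
          rw [IccExtend_of_mem _ _ hqI, IccExtend_of_mem _ _ (hmul ⟨q, hqI⟩)]
          rfl
        change _ = (s : ℝ) • ∫ q in (0 : ℝ)..r, IccExtend hI (Xc.comp w) q
        rw [intervalIntegral.integral_congr hc,
          intervalIntegral.smul_integral_comp_mul_left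
            (fun q => X (IccExtend hI (ψ (t, z)) q)) (s : ℝ), mul_zero]
    rw [hw]
    change ψ (t, z) _ = _
    congr 1
    ext
    simp
  have hev1 : ContDiff ℝ ∞ (fun y : C(I, Z) => y ⟨1, hone⟩) :=
    (ContinuousMap.evalCLM ℝ (⟨1, hone⟩ : I) : C(I, Z) →L[ℝ] Z).contDiff
  refine ⟨ε, hε, W', hW', hzW', fun a => ψ a ⟨1, hone⟩, ?_, ?_, ?_⟩
  · rintro ⟨t, z⟩ ⟨ht, hz⟩
    exact (hev1.contDiffAt.comp _ (H t ht z hz).1).contDiffWithinAt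
  · intro z hz
    have := hint 0 (by simpa using hε) z hz ⟨1, hone⟩
    simpa using this
  · intro z hz t ht
    -- For a fixed `T'` with `|t| < T' < ε` the single curve `ψ(T', z)` describes `F(τ, z)` for all
    -- `τ` near `t`, and the integral can be differentiated at the interior point `t / T'`.
    obtain ⟨T', hT', hT'ε⟩ := exists_between (abs_lt.2 ht)
    have hT'0 : 0 < T' := (abs_nonneg t).trans_lt hT'
    have hT'm : T' ∈ Ioo (-ε) ε := ⟨by linarith, hT'ε⟩
    have hdiv : ∀ τ ∈ Ioo (-T') T', τ / T' ∈ I := fun τ hτ =>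
      ⟨by rw [le_div_iff₀ hT'0]; linarith [hτ.1], by rw [div_le_iff₀ hT'0]; linarith [hτ.2]⟩
    have htT : t ∈ Ioo (-T') T' := abs_lt.1 hT'
    have hF : ∀ τ ∈ Ioo (-T') T', ψ (τ, z) ⟨1, hone⟩ =
        z + T' • ∫ r in (0 : ℝ)..(τ / T'), X (IccExtend hI (ψ (T', z)) r) := by
      intro τ hτ
      have := hscale T' hT'm z hz ⟨τ / T', hdiv τ hτ⟩
      rw [hint T' hT'm z hz] at this
      simpa [mul_div_cancel₀ _ hT'0.ne'] using this
    have hFt : ψ (t, z) ⟨1, hone⟩ = IccExtend hI (ψ (T', z)) (t / T') := by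
      have := hscale T' hT'm z hz ⟨t / T', hdiv t htT⟩
      rw [IccExtend_of_mem _ _ (hdiv t htT), ← this]
      simp [mul_div_cancel₀ _ hT'0.ne']
    have hcont : Continuous fun r => X (IccExtend hI (ψ (T', z)) r) :=
      hX.continuous.comp (ψ (T', z)).continuous.Icc_extend'
    have h1 := (hcont.integral_hasStrictDerivAt 0 (t / T')).hasDerivAt
    have h2 := ((h1.scomp t ((hasDerivAt_id t).div_const T')).const_smul T').const_add z
    have h3 : T' • (1 / T') • X (IccExtend hI (ψ (T', z)) (t / T')) = X (ψ (t, z) ⟨1, hone⟩) := by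
      rw [hFt, smul_smul, mul_one_div_cancel hT'0.ne', one_smul]
    rw [h3] at h2
    refine h2.congr_of_eventuallyEq ?_
    filter_upwards [isOpen_Ioo.mem_nhds htT] with τ hτ
    exact hF τ hτ

/-- A vector field which is smooth on an open set has, near every point of the set, a smooth local
flow with values in the set. -/
theorem exists_smooth_local_flow_of_contDiffOn [FiniteDimensional ℝ Z] {X : Z → Z} {D : Set Z}
    (hD : IsOpen D) (hX : ContDiffOn ℝ ∞ X D) {z₀ : Z} (hz₀ : z₀ ∈ D) :
    ∃ ε : ℝ, 0 < ε ∧ ∃ W : Set Z, IsOpen W ∧ z₀ ∈ W ∧ ∃ F : ℝ × Z → Z,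
      ContDiffOn ℝ ∞ F (Ioo (-ε) ε ×ˢ W) ∧ (∀ z ∈ W, F (0, z) = z) ∧
      ∀ z ∈ W, ∀ t ∈ Ioo (-ε) ε, F (t, z) ∈ D ∧
        HasDerivAt (fun τ => F (τ, z)) (X (F (t, z))) t := by
  obtain ⟨r, hr, hrD⟩ := Metric.isOpen_iff.1 hD z₀ hz₀
  -- The cut-off field is smooth on the whole space and equals `X` on the ball of radius `r / 4`.
  -- Time and initial points are restricted below so that the flow stays in this ball.
  let b : ContDiffBump z₀ := ⟨r / 4, r / 2, by positivity, by linarith⟩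
  have hsub : Metric.closedBall z₀ (r / 2) ⊆ D :=
    (Metric.closedBall_subset_ball (by linarith)).trans hrD
  have hsm : ContDiff ℝ ∞ fun z => b z • X z := by
    rw [contDiff_iff_contDiffAt]
    intro z
    by_cases hz : z ∈ D
    · exact b.contDiff.contDiffAt.smul (hX.contDiffAt (hD.mem_nhds hz))
    · have : (fun z => b z • X z) =ᶠ[𝓝 z] fun _ => 0 := by
        have hz' : z ∈ (Metric.closedBall z₀ (r / 2))ᶜ := fun h => hz (hsub h)
        filter_upwards [Metric.isClosed_closedBall.isOpen_compl.mem_nhds hz'] with w hw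
        rw [b.zero_of_le_dist, zero_smul]
        simp only [Metric.mem_closedBall, mem_compl_iff, not_le] at hw
        exact hw.le
      exact contDiffAt_const.congr_of_eventuallyEq this
  obtain ⟨ε, hε, W, hW, hz₀W, F, hF, hF0, hFd⟩ := exists_smooth_local_flow hsm z₀
  have hc : ContinuousAt F (0, z₀) :=
    hF.continuousOn.continuousAt ((isOpen_Ioo.prod hW).mem_nhds ⟨by simpa using hε, hz₀W⟩)
  have hball : ∀ᶠ a in 𝓝 ((0 : ℝ), z₀), F a ∈ Metric.ball z₀ (r / 4) := by
    refine hc.eventually ?_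
    rw [hF0 z₀ hz₀W]
    exact Metric.ball_mem_nhds _ (by positivity)
  obtain ⟨T, hT, W₁, hW₁, hTW⟩ := mem_nhds_prod_iff.1 hball
  obtain ⟨ε₁, hε₁, hTε⟩ := Metric.mem_nhds_iff.1 hT
  obtain ⟨W₂, hW₂W, hW₂, hzW₂⟩ := mem_nhds_iff.1 hW₁
  have hlt : ∀ t ∈ Ioo (-(min ε ε₁)) (min ε ε₁), t ∈ Ioo (-ε) ε ∧ t ∈ T := fun t ht => by
    have ht' := lt_min_iff.1 (abs_lt.2 ht)
    exact ⟨abs_lt.1 ht'.1, hTε (by simpa [Real.dist_eq] using ht'.2)⟩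
  refine ⟨min ε ε₁, lt_min hε hε₁, W ∩ W₂, hW.inter hW₂, ⟨hz₀W, hzW₂⟩, F,
    hF.mono fun a ha => ⟨(hlt _ ha.1).1, ha.2.1⟩, fun z hz => hF0 z hz.1, fun z hz t ht => ?_⟩
  have hmem : F (t, z) ∈ Metric.ball z₀ (r / 4) := hTW (mk_mem_prod (hlt t ht).2 (hW₂W hz.2))
  refine ⟨hsub ((Metric.ball_subset_closedBall.trans
    (Metric.closedBall_subset_closedBall (by linarith))) hmem), ?_⟩
  have := hFd z hz.1 t (hlt t ht).1
  rwa [b.one_of_mem_closedBall (Metric.ball_subset_closedBall hmem), one_smul] at this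

end Flow

namespace NormalShift

/-! ### Coordinates on the cotangent bundle -/

section Coordinates

variable {n : ℕ} {M : Type u} [TopologicalSpace M] [ChartedSpace (Euc n) M]

section NoManifold

variable {φ : OpenPartialHomeomorph M (Euc n)}

/-- The differential of a chart, with values in the model space. -/
abbrev chartDeriv (φ : OpenPartialHomeomorph M (Euc n)) (x : M) :
    TangentSpace (𝓡 n) x →L[ℝ] Euc n := mfderiv (𝓡 n) (𝓡 n) φ x

theorem IsChart.contMDiffOn (hφ : IsChart φ) : ContMDiffOn (𝓡 n) (𝓡 n) ∞ φ φ.source :=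
  contMDiffOn_of_mem_maximalAtlas hφ

theorem IsChart.contMDiffAt (hφ : IsChart φ) {x : M} (hx : x ∈ φ.source) :
    ContMDiffAt (𝓡 n) (𝓡 n) ∞ φ x :=
  contMDiffAt_of_mem_maximalAtlas hφ hx

theorem IsChart.contMDiffOn_symm (hφ : IsChart φ) :
    ContMDiffOn (𝓡 n) (𝓡 n) ∞ φ.symm φ.target :=
  contMDiffOn_symm_of_mem_maximalAtlas hφ

theorem IsChart.contMDiffAt_symm (hφ : IsChart φ) {x : Euc n} (hx : x ∈ φ.target) :
    ContMDiffAt (𝓡 n) (𝓡 n) ∞ φ.symm x :=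
  hφ.contMDiffOn_symm.contMDiffAt (φ.open_target.mem_nhds hx)

theorem IsChart.mdifferentiable (hφ : IsChart φ) : φ.MDifferentiable (𝓡 n) (𝓡 n) :=
  ⟨hφ.contMDiffOn.mdifferentiableOn (by simp), hφ.contMDiffOn_symm.mdifferentiableOn (by simp)⟩

theorem IsChart.coordVec_eq (hφ : IsChart φ) {x : M} (hx : x ∈ φ.source) (i : Fin n) :
    coordVec φ x i = mfderiv (𝓡 n) (𝓡 n) φ.symm (φ x) (EuclideanSpace.single i (1 : ℝ)) := by
  have h1 := hφ.mdifferentiable.symm_comp_deriv hx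
  have h2 := hφ.mdifferentiable.comp_symm_deriv (φ.map_source hx)
  rw [φ.left_inv hx] at h2
  unfold coordVec
  rw [ContinuousLinearMap.inverse_eq h2 h1]
  rfl

theorem IsChart.mfderiv_coordVec (hφ : IsChart φ) {x : M} (hx : x ∈ φ.source) (i : Fin n) :
    chartDeriv φ x (coordVec φ x i) = EuclideanSpace.single i (1 : ℝ) := by
  rw [hφ.coordVec_eq hx]
  have h2 := hφ.mdifferentiable.comp_symm_deriv (φ.map_source hx)
  rw [φ.left_inv hx] at h2
  exact congrArg (fun L : Euc n →L[ℝ] Euc n => L (EuclideanSpace.single i (1 : ℝ))) h2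

theorem euc_eq_sum (v : Euc n) : v = ∑ i, v i • EuclideanSpace.single i (1 : ℝ) := by
  ext j
  simp [Finset.sum_apply, Pi.single_apply]

theorem IsChart.eq_sum_coordVec (hφ : IsChart φ) {x : M} (hx : x ∈ φ.source)
    (v : TangentSpace (𝓡 n) x) :
    v = ∑ i, chartDeriv φ x v i • coordVec φ x i := by
  have h : Function.Injective (chartDeriv φ x) := hφ.mdifferentiable.mfderiv_injective hx
  apply h
  rw [map_sum]
  simp only [map_smul]
  conv_lhs => rw [euc_eq_sum (chartDeriv φ x v)]
  refine Finset.sum_congr rfl fun i _ => ?_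
  congr 1
  exact (hφ.mfderiv_coordVec hx i).symm

theorem IsChart.covector_apply (hφ : IsChart φ) {q : CotangentBundle n M}
    (hq : q.proj ∈ φ.source) (v : TangentSpace (𝓡 n) q.proj) :
    q.2 v = ∑ i, momentum φ q i * chartDeriv φ q.proj v i := by
  conv_lhs => rw [hφ.eq_sum_coordVec hq v]
  rw [map_sum]
  refine Finset.sum_congr rfl fun i _ => ?_
  rw [map_smul, smul_eq_mul, mul_comm]
  rfl

theorem ofCoords_snd_apply (x : Euc n) (p : Fin n → ℝ) (v : TangentSpace (𝓡 n) (φ.symm x)) :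
    (ofCoords φ x p).2 v = ∑ i, p i * chartDeriv φ (φ.symm x) v i := by
  change (∑ i, p i • coordCovec φ (φ.symm x) i : TangentSpace (𝓡 n) (φ.symm x) →L[ℝ] ℝ) v = _
  rw [_root_.sum_apply]
  rfl

theorem IsChart.momentum_ofCoords (hφ : IsChart φ) {x : Euc n} (hx : x ∈ φ.target)
    (p : Fin n → ℝ) : momentum φ (ofCoords φ x p) = p := by
  funext j
  have hs : φ.symm x ∈ φ.source := φ.map_target hx
  change (ofCoords φ x p).2 (coordVec φ (φ.symm x) j) = _
  rw [ofCoords_snd_apply, hφ.mfderiv_coordVec hs]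
  simp

/-- All fibres are the same type `Euc n →L[ℝ] ℝ` by definition, so covectors at equal but not
syntactically equal base points can be compared there. -/
theorem cotangent_ext {x y : M} (h : x = y) {A : TangentSpace (𝓡 n) x →L[ℝ] ℝ}
    {B : TangentSpace (𝓡 n) y →L[ℝ] ℝ} (hAB : (A : Euc n →L[ℝ] ℝ) = (B : Euc n →L[ℝ] ℝ)) :
    (⟨x, A⟩ : CotangentBundle n M) = ⟨y, B⟩ := by
  subst h
  exact congrArg _ hAB

theorem IsChart.ofCoords_momentum (hφ : IsChart φ) {q : CotangentBundle n M}
    (hq : q.proj ∈ φ.source) : ofCoords φ (φ q.proj) (momentum φ q) = q := by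
  obtain ⟨x, P⟩ := q
  have hx : φ.symm (φ x) = x := φ.left_inv hq
  refine cotangent_ext hx ?_
  have key : ∀ z, z = x → ((∑ i, momentum φ ⟨x, P⟩ i • coordCovec φ z i :
      TangentSpace (𝓡 n) z →L[ℝ] ℝ) : Euc n →L[ℝ] ℝ) = P := by
    rintro z rfl
    ext v
    rw [_root_.sum_apply]
    exact (hφ.covector_apply (q := ⟨z, P⟩) hq v).symm
  exact key _ hx

theorem IsChart.momentum_eq_zero_iff (hφ : IsChart φ) {q : CotangentBundle n M}
    (hq : q.proj ∈ φ.source) : momentum φ q = 0 ↔ q.2 = 0 := by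
  constructor
  · intro h
    ext v
    rw [hφ.covector_apply hq v, h]
    simp
  · intro h
    funext i
    unfold momentum
    rw [h]
    rfl

theorem IsChart.coords_mem (hφ : IsChart φ) {q : CotangentBundle n M}
    (hq : q.proj ∈ φ.source) (hq0 : q.2 ≠ 0) : (φ q.proj, momentum φ q) ∈ coordDomain φ :=
  ⟨φ.map_source hq, fun h => hq0 ((hφ.momentum_eq_zero_iff hq).1 h)⟩

theorem IsChart.ofCoords_ne_zero (hφ : IsChart φ) {x : Euc n} {p : Fin n → ℝ}
    (h : (x, p) ∈ coordDomain φ) : (ofCoords φ x p).2 ≠ 0 := fun h0 => h.2 (by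
  have := (hφ.momentum_eq_zero_iff (q := ofCoords φ x p) (φ.map_target h.1)).2 h0
  rwa [hφ.momentum_ofCoords h.1] at this)

omit [ChartedSpace (Euc n) M] in
theorem isOpen_coordDomain (φ : OpenPartialHomeomorph M (Euc n)) : IsOpen (coordDomain φ) :=
  (φ.open_target.preimage continuous_fst).inter (isOpen_ne.preimage continuous_snd)

end NoManifold

/-! ### Smoothness of the coordinates of the cotangent bundle -/

section Manifold

variable [IsManifold (𝓡 n) ∞ M] {φ : OpenPartialHomeomorph M (Euc n)}

/-- The coordinate field is the image of a constant field under the tangent map of `φ.symm`. -/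
theorem IsChart.contMDiffOn_coordVec (hφ : IsChart φ) (i : Fin n) :
    ContMDiffOn (𝓡 n) (𝓡 n).tangent ∞
      (fun x => (⟨x, coordVec φ x i⟩ : TangentBundle (𝓡 n) M)) φ.source := by
  have : IsManifold (𝓡 n) 1 M := IsManifold.of_le (n := ∞) (by simp)
  have h1 := hφ.contMDiffOn_symm.contMDiffOn_tangentMapWithin (m := ∞) (by simp)
    φ.open_target.uniqueMDiffOn
  have h2 : ContMDiffOn (𝓡 n) (𝓡 n).tangent ∞
      (fun x => (⟨φ x, EuclideanSpace.single i (1 : ℝ)⟩ : TangentBundle (𝓡 n) (Euc n)))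
      φ.source := by
    have h3 : ContMDiff (𝓡 n) (𝓡 n).tangent ∞
        (fun x => (⟨x, EuclideanSpace.single i (1 : ℝ)⟩ : TangentBundle (𝓡 n) (Euc n))) :=
      contMDiff_vectorSpace_iff_contDiff.2 contDiff_const
    exact h3.comp_contMDiffOn hφ.contMDiffOn
  refine (h1.comp h2 fun x hx => φ.map_source hx).congr fun x hx => ?_
  have key : ∀ (y z : M) (_ : y = z) (v : Euc n),
      (⟨y, v⟩ : TangentBundle (𝓡 n) M) = ⟨z, v⟩ := by rintro y _ rfl v; rfl
  rw [hφ.coordVec_eq hx]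
  have := key x (φ.symm (φ x)) (φ.left_inv hx).symm
    (mfderiv (𝓡 n) (𝓡 n) φ.symm (φ x) (EuclideanSpace.single i (1 : ℝ)))
  rw [Function.comp_apply, tangentMapWithin]
  simp only
  rw [mfderivWithin_of_mem_nhds (φ.open_target.mem_nhds (φ.map_source hx))]
  exact this

theorem contMDiff_cotangent_proj :
    ContMDiff (cotModel n) (𝓡 n) ∞ (fun q : CotangentBundle n M => q.proj) :=
  contMDiff_proj _

/-- The component is the pairing of the point `q`, viewed as a covector over its base point, with a
smooth field of vectors. -/
theorem IsChart.contMDiffOn_momentum_apply (hφ : IsChart φ) (i : Fin n) :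
    ContMDiffOn (cotModel n) 𝓘(ℝ, ℝ) ∞ (fun q : CotangentBundle n M => momentum φ q i)
      {q | q.proj ∈ φ.source} := by
  have h1 : ContMDiffOn (cotModel n) (cotModel n) ∞ (fun q : CotangentBundle n M => q)
    {q | q.proj ∈ φ.source} := contMDiffOn_id
  have h2 : ContMDiffOn (cotModel n) (𝓡 n).tangent ∞ (fun q : CotangentBundle n M =>
      (⟨q.proj, coordVec φ q.proj i⟩ : TangentBundle (𝓡 n) M)) {q | q.proj ∈ φ.source} :=
    (hφ.contMDiffOn_coordVec i).comp contMDiff_cotangent_proj.contMDiffOn fun q hq => hq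
  have h3 := ContMDiffOn.clm_bundle_apply (E₂ := Trivial M ℝ) h1 h2
  intro q hq
  exact ((contMDiffWithinAt_totalSpace.1 (h3 q hq)).2).congr (fun _ _ => rfl) rfl

/-- The coordinates `x¹, …, xⁿ, p₁, …, pₙ` of a point of `T*M`. -/
def coords (φ : OpenPartialHomeomorph M (Euc n)) (q : CotangentBundle n M) :
    Euc n × (Fin n → ℝ) := (φ q.proj, momentum φ q)

theorem IsChart.contMDiffOn_coords (hφ : IsChart φ) :
    ContMDiffOn (cotModel n) 𝓘(ℝ, Euc n × (Fin n → ℝ)) ∞ (coords φ) {q | q.proj ∈ φ.source} := by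
  have h1 : ContMDiffOn (cotModel n) (𝓡 n) ∞ (fun q : CotangentBundle n M => φ q.proj)
      {q | q.proj ∈ φ.source} :=
    hφ.contMDiffOn.comp contMDiff_cotangent_proj.contMDiffOn fun q hq => hq
  have h2 : ContMDiffOn (cotModel n) 𝓘(ℝ, Fin n → ℝ) ∞ (fun q : CotangentBundle n M =>
      momentum φ q) {q | q.proj ∈ φ.source} :=
    contMDiffOn_pi_space.2 hφ.contMDiffOn_momentum_apply
  exact h1.prodMk_space h2

theorem IsChart.contMDiffOn_ofCoords (hφ : IsChart φ) :
    ContMDiffOn 𝓘(ℝ, Euc n × (Fin n → ℝ)) (cotModel n) ∞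
      (fun z => ofCoords φ z.1 z.2 : Euc n × (Fin n → ℝ) → CotangentBundle n M)
      (φ.target ×ˢ univ) := by
  have : IsManifold (𝓡 n) 1 M := IsManifold.of_le (n := ∞) (by simp)
  rintro ⟨x₀, p₀⟩ ⟨hx₀, -⟩
  refine ContMDiffAt.contMDiffWithinAt ?_
  rw [contMDiffAt_hom_bundle]
  have hfst : ContMDiffAt 𝓘(ℝ, Euc n × (Fin n → ℝ)) (𝓡 n) ∞
      (fun z : Euc n × (Fin n → ℝ) => φ.symm z.1) (x₀, p₀) :=
    ContMDiffAt.comp (x₀, p₀) (hφ.contMDiffAt_symm hx₀) contDiff_fst.contMDiff.contMDiffAt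
  refine ⟨hfst, ?_⟩
  have h1 := (hφ.contMDiffAt (φ.map_target hx₀)).mfderiv_const (m := ∞) (by simp)
  have h2 := ContMDiffAt.comp (x₀, p₀) h1 hfst
  have h3 : ContMDiffAt 𝓘(ℝ, Euc n × (Fin n → ℝ)) 𝓘(ℝ, Euc n →L[ℝ] ℝ) ∞
      (fun z : Euc n × (Fin n → ℝ) => ∑ i, z.2 i • (EuclideanSpace.proj i : Euc n →L[ℝ] ℝ).comp
        (inTangentCoordinates (𝓡 n) (𝓡 n) id φ (mfderiv (𝓡 n) (𝓡 n) φ) (φ.symm x₀)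
          (φ.symm z.1))) (x₀, p₀) := by
    rw [contMDiffAt_iff_contDiffAt]
    have h4 := h2.contDiffAt
    refine ContDiffAt.sum fun i _ => ?_
    have h5 : ContDiffAt ℝ ∞ (fun z : Euc n × (Fin n → ℝ) => z.2 i) (x₀, p₀) := by fun_prop
    exact h5.smul (contDiffAt_const.clm_comp h4)
  refine h3.congr_of_eventuallyEq (Filter.Eventually.of_forall fun z => ?_)
  ext v
  simp only [inTangentCoordinates, ContinuousLinearMap.inCoordinates,
    _root_.sum_apply]
  simp [TangentBundle.continuousLinearMapAt_model_space]
  exact ofCoords_snd_apply (φ := φ) _ _ _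

end Manifold
end Coordinates

/-! ### Changes of charts -/

section Transition

variable {n : ℕ} {M : Type u} [TopologicalSpace M] [ChartedSpace (Euc n) M]
  {φ ψ : OpenPartialHomeomorph M (Euc n)}

omit [ChartedSpace (Euc n) M] in
theorem isOpen_overlap (φ ψ : OpenPartialHomeomorph M (Euc n)) :
    IsOpen {x | x ∈ φ.target ∧ φ.symm x ∈ ψ.source} :=
  (φ.symm.trans ψ).open_source

omit [ChartedSpace (Euc n) M] in
theorem changeX_mem {x : Euc n} (hs : φ.symm x ∈ ψ.source) : changeX φ ψ x ∈ ψ.target :=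
  ψ.map_source hs

omit [ChartedSpace (Euc n) M] in
theorem symm_changeX {x : Euc n} (hs : φ.symm x ∈ ψ.source) :
    ψ.symm (changeX φ ψ x) = φ.symm x := ψ.left_inv hs

omit [ChartedSpace (Euc n) M] in
theorem symm_changeX_mem {x : Euc n} (hx : x ∈ φ.target) (hs : φ.symm x ∈ ψ.source) :
    ψ.symm (changeX φ ψ x) ∈ φ.source := by
  rw [symm_changeX hs]; exact φ.map_target hx

omit [ChartedSpace (Euc n) M] in
theorem changeX_changeX {x : Euc n} (hx : x ∈ φ.target) (hs : φ.symm x ∈ ψ.source) :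
    changeX ψ φ (changeX φ ψ x) = x := by
  change φ (ψ.symm (changeX φ ψ x)) = x
  rw [symm_changeX hs, φ.right_inv hx]

theorem contDiffAt_changeX (hφ : IsChart φ) (hψ : IsChart ψ) {x : Euc n} (hx : x ∈ φ.target)
    (hs : φ.symm x ∈ ψ.source) : ContDiffAt ℝ ∞ (changeX φ ψ) x :=
  ((hψ.contMDiffAt hs).comp x (hφ.contMDiffAt_symm hx)).contDiffAt

theorem contDiffAt_jac (hφ : IsChart φ) (hψ : IsChart ψ) {x : Euc n} (hx : x ∈ φ.target)
    (hs : φ.symm x ∈ ψ.source) (i j : Fin n) : ContDiffAt ℝ ∞ (fun z => jac φ ψ z i j) x := by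
  have h : ContDiffAt ℝ ∞ (fderiv ℝ (changeX φ ψ)) x :=
    (contDiffAt_changeX hφ hψ hx hs).fderiv_right (by simp)
  have h2 : ContDiffAt ℝ ∞
      (fun z => fderiv ℝ (changeX φ ψ) z (EuclideanSpace.single j (1 : ℝ))) x :=
    h.clm_apply contDiffAt_const
  exact (EuclideanSpace.proj i : Euc n →L[ℝ] ℝ).contDiff.contDiffAt.comp x h2

omit [ChartedSpace (Euc n) M] in
theorem fderiv_changeX_apply (x u : Euc n) (i : Fin n) :
    fderiv ℝ (changeX φ ψ) x u i = ∑ j, jac φ ψ x i j * u j := by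
  conv_lhs => rw [euc_eq_sum u]
  rw [map_sum]
  simp only [map_smul, WithLp.ofLp_sum, Finset.sum_apply, PiLp.smul_apply, smul_eq_mul]
  exact Finset.sum_congr rfl fun j _ => mul_comm _ _

theorem fderiv_jac_symm (hφ : IsChart φ) (hψ : IsChart ψ) {x : Euc n} (hx : x ∈ φ.target)
    (hs : φ.symm x ∈ ψ.source) (m i j : Fin n) :
    fderiv ℝ (fun z => jac φ ψ z m i) x (EuclideanSpace.single j 1) =
      fderiv ℝ (fun z => jac φ ψ z m j) x (EuclideanSpace.single i 1) := by
  have hc := contDiffAt_changeX hφ hψ hx hs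
  have h : DifferentiableAt ℝ (fderiv ℝ (changeX φ ψ)) x :=
    (hc.fderiv_right (m := ∞) (by simp)).differentiableAt (by simp)
  have key : ∀ i j : Fin n, fderiv ℝ (fun z => jac φ ψ z m i) x (EuclideanSpace.single j 1) =
      (fderiv ℝ (fderiv ℝ (changeX φ ψ)) x (EuclideanSpace.single j 1)
        (EuclideanSpace.single i 1)) m := by
    intro i j
    have h1 : HasFDerivAt (fun z => fderiv ℝ (changeX φ ψ) z (EuclideanSpace.single i (1 : ℝ)))
        ((fderiv ℝ (fderiv ℝ (changeX φ ψ)) x).flip (EuclideanSpace.single i (1 : ℝ))) x := by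
      simpa using h.hasFDerivAt.clm_apply
        (hasFDerivAt_const (EuclideanSpace.single i (1 : ℝ)) x)
    have h2 := (EuclideanSpace.proj m : Euc n →L[ℝ] ℝ).hasFDerivAt.comp x h1
    have h3 : HasFDerivAt (fun z => jac φ ψ z m i) _ x := h2
    rw [h3.fderiv]
    rfl
  rw [key, key]
  have hsymm := hc.isSymmSndFDerivAt (by
    simpa using (mod_cast le_top : ((2 : ℕ∞) : ℕ∞ω) ≤ ((⊤ : ℕ∞) : ℕ∞ω)))
  rw [hsymm.eq]

theorem sum_jac_mul_jac (hφ : IsChart φ) (hψ : IsChart ψ) {x : Euc n} (hx : x ∈ φ.target)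
    (hs : φ.symm x ∈ ψ.source) (i k : Fin n) :
    ∑ j, jac ψ φ (changeX φ ψ x) i j * jac φ ψ x j k = if i = k then 1 else 0 := by
  have h1 := (contDiffAt_changeX hφ hψ hx hs).differentiableAt (by simp)
  have h2 := (contDiffAt_changeX hψ hφ (changeX_mem hs) (symm_changeX_mem hx hs)).differentiableAt
    (by simp)
  have h3 := h2.hasFDerivAt.comp x h1.hasFDerivAt
  have h4 : HasFDerivAt (changeX ψ φ ∘ changeX φ ψ) (ContinuousLinearMap.id ℝ (Euc n)) x := by
    refine (hasFDerivAt_id x).congr_of_eventuallyEq ?_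
    filter_upwards [(isOpen_overlap φ ψ).mem_nhds ⟨hx, hs⟩] with z hz
    exact changeX_changeX hz.1 hz.2
  have h5 := congrArg (fun L : Euc n →L[ℝ] Euc n => L (EuclideanSpace.single k (1 : ℝ)) i)
    (h3.unique h4)
  simp only [ContinuousLinearMap.comp_apply, fderiv_changeX_apply] at h5
  simpa [Pi.single_apply] using h5

/-- The Jacobi matrix of a change of coordinates. -/
def jacM (φ ψ : OpenPartialHomeomorph M (Euc n)) (x : Euc n) : Matrix (Fin n) (Fin n) ℝ :=
  Matrix.of fun i j => jac φ ψ x i j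

theorem jacM_mul_jacM (hφ : IsChart φ) (hψ : IsChart ψ) {x : Euc n} (hx : x ∈ φ.target)
    (hs : φ.symm x ∈ ψ.source) : jacM ψ φ (changeX φ ψ x) * jacM φ ψ x = 1 := by
  ext i k
  rw [Matrix.mul_apply, Matrix.one_apply]
  exact sum_jac_mul_jac hφ hψ hx hs i k

theorem jacM_mul_jacM' (hφ : IsChart φ) (hψ : IsChart ψ) {x : Euc n} (hx : x ∈ φ.target)
    (hs : φ.symm x ∈ ψ.source) : jacM φ ψ x * jacM ψ φ (changeX φ ψ x) = 1 :=
  mul_eq_one_comm.1 (jacM_mul_jacM hφ hψ hx hs)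

omit [ChartedSpace (Euc n) M] in
theorem changeP_eq (x : Euc n) (p : Fin n → ℝ) :
    changeP φ ψ x p = (jacM ψ φ (changeX φ ψ x)).transpose.mulVec p := rfl

/-- The Jacobi matrices in the two directions are inverse to each other, so the zero section is
respected. -/
theorem changeP_eq_zero (hφ : IsChart φ) (hψ : IsChart ψ) {x : Euc n} {p : Fin n → ℝ}
    (hx : x ∈ φ.target) (hs : φ.symm x ∈ ψ.source) (h : changeP φ ψ x p = 0) : p = 0 := by
  have h1 := congrArg (fun v => (jacM φ ψ x).transpose.mulVec v) h
  simp only [changeP_eq, Matrix.mulVec_mulVec, ← Matrix.transpose_mul,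
    jacM_mul_jacM hφ hψ hx hs, Matrix.transpose_one, Matrix.one_mulVec, Matrix.mulVec_zero] at h1
  exact h1

theorem change_mem_coordDomain (hφ : IsChart φ) (hψ : IsChart ψ) {x : Euc n} {p : Fin n → ℝ}
    (h : (x, p) ∈ coordOverlap φ ψ) : (changeX φ ψ x, changeP φ ψ x p) ∈ coordDomain ψ :=
  ⟨changeX_mem h.2, fun h0 => h.1.2 (changeP_eq_zero hφ hψ h.1.1 h.2 h0)⟩

theorem momentum_change (hφ : IsChart φ) (hψ : IsChart ψ) {q : CotangentBundle n M}
    (hq : q.proj ∈ φ.source) (hq' : q.proj ∈ ψ.source) :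
    momentum ψ q = changeP φ ψ (φ q.proj) (momentum φ q) := by
  funext a
  have hsx : φ.symm (φ q.proj) = q.proj := φ.left_inv hq
  have hX : changeX φ ψ (φ q.proj) = ψ q.proj := congrArg ψ hsx
  change q.2 (coordVec ψ q.proj a) = _
  rw [hφ.covector_apply hq]
  refine Finset.sum_congr rfl fun i _ => ?_
  rw [mul_comm, hX]
  congr 1
  have h1 : MDifferentiableAt (𝓡 n) (𝓡 n) φ (ψ.symm (ψ q.proj)) := by
    rw [ψ.left_inv hq']; exact hφ.mdifferentiable.mdifferentiableAt hq
  have h2 := mfderiv_comp (ψ q.proj) h1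
    (hψ.mdifferentiable.mdifferentiableAt_symm (ψ.map_source hq'))
  rw [mfderiv_eq_fderiv, ψ.left_inv hq'] at h2
  rw [hψ.coordVec_eq hq']
  exact (congrArg (fun L : Euc n →L[ℝ] Euc n => L (EuclideanSpace.single a (1 : ℝ)) i) h2).symm

theorem ofCoords_change (hφ : IsChart φ) (hψ : IsChart ψ) {x : Euc n} (p : Fin n → ℝ)
    (hx : x ∈ φ.target) (hs : φ.symm x ∈ ψ.source) :
    ofCoords ψ (changeX φ ψ x) (changeP φ ψ x p) = ofCoords φ x p := by
  have h := hψ.ofCoords_momentum (q := ofCoords φ x p) hs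
  rw [momentum_change (q := ofCoords φ x p) hφ hψ (φ.map_target hx) hs,
    hφ.momentum_ofCoords hx] at h
  have hφx : φ (ofCoords φ x p).proj = x := φ.right_inv hx
  rw [hφx] at h
  exact h

/-- The matrix `P_{ab} = Σₖ pₖ ∂²xᵏ/∂x̃ᵃ∂x̃ᵇ` at the point with `φ`-coordinates `x, p`. -/
def hessM (φ ψ : OpenPartialHomeomorph M (Euc n)) (x : Euc n) (p : Fin n → ℝ) :
    Matrix (Fin n) (Fin n) ℝ :=
  Matrix.of fun a b => ∑ k, p k *
    fderiv ℝ (fun y => jac ψ φ y k a) (changeX φ ψ x) (EuclideanSpace.single b 1)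

theorem hessM_transpose (hφ : IsChart φ) (hψ : IsChart ψ) {x : Euc n} (p : Fin n → ℝ)
    (hx : x ∈ φ.target) (hs : φ.symm x ∈ ψ.source) :
    (hessM φ ψ x p).transpose = hessM φ ψ x p := by
  ext a b
  simp only [Matrix.transpose_apply, hessM, Matrix.of_apply]
  refine Finset.sum_congr rfl fun k _ => ?_
  rw [fderiv_jac_symm hψ hφ (changeX_mem hs) (symm_changeX_mem hx hs)]

/-- The derivative of the change of the coordinates `x, p`, in matrix form. -/
theorem hasFDerivAt_changeP (hφ : IsChart φ) (hψ : IsChart ψ) {x : Euc n} (p : Fin n → ℝ)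
    (hx : x ∈ φ.target) (hs : φ.symm x ∈ ψ.source) :
    ∃ L : Euc n × (Fin n → ℝ) →L[ℝ] (Fin n → ℝ),
      HasFDerivAt (fun z : Euc n × (Fin n → ℝ) => changeP φ ψ z.1 z.2) L (x, p) ∧
      ∀ u w, L (u, w) = (hessM φ ψ x p).mulVec ((jacM φ ψ x).mulVec u) +
        (jacM ψ φ (changeX φ ψ x)).transpose.mulVec w := by
  have hX : HasFDerivAt (fun z : Euc n × (Fin n → ℝ) => changeX φ ψ z.1)
      ((fderiv ℝ (changeX φ ψ) x).comp (ContinuousLinearMap.fst ℝ _ _)) (x, p) :=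
    HasFDerivAt.comp (x, p) (g := changeX φ ψ) (f := Prod.fst)
      ((contDiffAt_changeX hφ hψ hx hs).differentiableAt (by simp)).hasFDerivAt hasFDerivAt_fst
  have hJ : ∀ i a, HasFDerivAt (fun z : Euc n × (Fin n → ℝ) => jac ψ φ (changeX φ ψ z.1) i a)
      ((fderiv ℝ (fun y => jac ψ φ y i a) (changeX φ ψ x)).comp
        ((fderiv ℝ (changeX φ ψ) x).comp (ContinuousLinearMap.fst ℝ _ _))) (x, p) := fun i a =>
    HasFDerivAt.comp (x, p) (g := fun y => jac ψ φ y i a)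
      (f := fun z : Euc n × (Fin n → ℝ) => changeX φ ψ z.1) (((contDiffAt_jac hψ hφ (changeX_mem hs)
      (symm_changeX_mem hx hs) i a).differentiableAt (by simp)).hasFDerivAt) hX
  have hp : ∀ i, HasFDerivAt (fun z : Euc n × (Fin n → ℝ) => z.2 i)
      ((ContinuousLinearMap.proj i).comp (ContinuousLinearMap.snd ℝ _ _)) (x, p) := fun i =>
    ((ContinuousLinearMap.proj i).comp
      (ContinuousLinearMap.snd ℝ (Euc n) (Fin n → ℝ))).hasFDerivAt
  have hP := hasFDerivAt_pi.2 fun a => HasFDerivAt.fun_sum (u := Finset.univ)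
    fun i _ => (hJ i a).mul (hp i)
  refine ⟨_, hP, fun u w => ?_⟩
  funext a
  have hlin : ∀ k, fderiv ℝ (fun y => jac ψ φ y k a) (changeX φ ψ x)
      (fderiv ℝ (changeX φ ψ) x u) = ∑ b, (jacM φ ψ x).mulVec u b *
        fderiv ℝ (fun y => jac ψ φ y k a) (changeX φ ψ x) (EuclideanSpace.single b 1) := by
    intro k
    conv_lhs => rw [euc_eq_sum (fderiv ℝ (changeX φ ψ) x u)]
    rw [map_sum]
    refine Finset.sum_congr rfl fun b _ => ?_
    rw [map_smul, smul_eq_mul, fderiv_changeX_apply]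
    rfl
  simp only [ContinuousLinearMap.pi_apply, _root_.sum_apply, _root_.add_apply,
    _root_.smul_apply, ContinuousLinearMap.comp_apply,
    ContinuousLinearMap.coe_fst', ContinuousLinearMap.coe_snd', ContinuousLinearMap.proj_apply,
    smul_eq_mul, hlin, Pi.add_apply, Matrix.mulVec, dotProduct, hessM, jacM, Matrix.of_apply,
    Matrix.transpose_apply, Finset.sum_add_distrib]
  rw [add_comm]
  congr 1
  simp only [Finset.mul_sum, Finset.sum_mul]
  rw [Finset.sum_comm]
  refine Finset.sum_congr rfl fun b _ => ?_
  rw [Finset.sum_comm]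
  exact Finset.sum_congr rfl fun k _ => Finset.sum_congr rfl fun j _ => by ring

end Transition

/-! ### The modified Hamiltonian system in coordinates -/

section Partial

variable {n : ℕ}

theorem dx_eq {f : Euc n → (Fin n → ℝ) → ℝ} {x : Euc n} {p : Fin n → ℝ}
    {D : Euc n × (Fin n → ℝ) →L[ℝ] ℝ}
    (hf : HasFDerivAt (fun z : Euc n × (Fin n → ℝ) => f z.1 z.2) D (x, p)) (i : Fin n) :
    dx f i x p = D (EuclideanSpace.single i 1, 0) := by
  have h := HasFDerivAt.comp x (f := fun y => (y, p)) hf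
    ((hasFDerivAt_id x).prodMk (hasFDerivAt_const p x))
  have h' : HasFDerivAt (fun x' => f x' p) _ x := h
  unfold dx
  rw [h'.fderiv]
  rfl

theorem dp_eq {f : Euc n → (Fin n → ℝ) → ℝ} {x : Euc n} {p : Fin n → ℝ}
    {D : Euc n × (Fin n → ℝ) →L[ℝ] ℝ}
    (hf : HasFDerivAt (fun z : Euc n × (Fin n → ℝ) => f z.1 z.2) D (x, p)) (i : Fin n) :
    dp f i x p = D (0, Pi.single i 1) := by
  have h := HasFDerivAt.comp p (f := fun y => (x, y)) hf
    ((hasFDerivAt_const x p).prodMk (hasFDerivAt_id p))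
  have h' : HasFDerivAt (fun p' => f x p') _ p := h
  unfold dp
  rw [h'.fderiv]
  rfl

theorem fderiv_eq_dotProduct {f : Euc n → (Fin n → ℝ) → ℝ} {x : Euc n} {p : Fin n → ℝ}
    {D : Euc n × (Fin n → ℝ) →L[ℝ] ℝ}
    (hf : HasFDerivAt (fun z : Euc n × (Fin n → ℝ) => f z.1 z.2) D (x, p)) (u : Euc n)
    (w : Fin n → ℝ) :
    D (u, w) = (u : Fin n → ℝ) ⬝ᵥ (fun i => dx f i x p) + w ⬝ᵥ (fun i => dp f i x p) := by
  have h1 : D (u, w) = D (u, 0) + D (0, w) := by rw [← map_add]; simp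
  have h2 : D (u, 0) = D.comp (ContinuousLinearMap.inl ℝ _ _) u := rfl
  have h3 : D (0, w) = D.comp (ContinuousLinearMap.inr ℝ _ _) w := rfl
  rw [h1, h2, h3]
  congr 1
  · conv_lhs => rw [euc_eq_sum u]
    rw [map_sum]
    refine Finset.sum_congr rfl fun i _ => ?_
    rw [map_smul, smul_eq_mul]
    exact congrArg _ (dx_eq hf i).symm
  · conv_lhs => rw [pi_eq_sum_univ' w]
    rw [map_sum]
    refine Finset.sum_congr rfl fun i _ => ?_
    rw [map_smul, smul_eq_mul]
    exact congrArg _ (dp_eq hf i).symm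

theorem contDiffOn_dx {f : Euc n → (Fin n → ℝ) → ℝ} {D : Set (Euc n × (Fin n → ℝ))}
    (hD : IsOpen D) (hf : ContDiffOn ℝ ∞ (fun z : Euc n × (Fin n → ℝ) => f z.1 z.2) D)
    (i : Fin n) : ContDiffOn ℝ ∞ (fun z : Euc n × (Fin n → ℝ) => dx f i z.1 z.2) D := by
  have h : ContDiffOn ℝ ∞ (fderiv ℝ (fun z : Euc n × (Fin n → ℝ) => f z.1 z.2)) D :=
    hf.fderiv_of_isOpen hD (by simp)
  refine (h.clm_apply (contDiffOn_const (c := (EuclideanSpace.single i 1, 0)))).congr fun z hz => ?_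
  exact dx_eq ((hf.contDiffAt (hD.mem_nhds hz)).differentiableAt (by simp)).hasFDerivAt i

theorem contDiffOn_dp {f : Euc n → (Fin n → ℝ) → ℝ} {D : Set (Euc n × (Fin n → ℝ))}
    (hD : IsOpen D) (hf : ContDiffOn ℝ ∞ (fun z : Euc n × (Fin n → ℝ) => f z.1 z.2) D)
    (i : Fin n) : ContDiffOn ℝ ∞ (fun z : Euc n × (Fin n → ℝ) => dp f i z.1 z.2) D := by
  have h : ContDiffOn ℝ ∞ (fderiv ℝ (fun z : Euc n × (Fin n → ℝ) => f z.1 z.2)) D :=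
    hf.fderiv_of_isOpen hD (by simp)
  refine (h.clm_apply (contDiffOn_const (c := (0, Pi.single i 1)))).congr fun z hz => ?_
  exact dp_eq ((hf.contDiffAt (hD.mem_nhds hz)).differentiableAt (by simp)).hasFDerivAt i

end Partial

/-! ### Transformation laws of the gradients, the connection and the modified system -/

section Hamiltonian

variable {n : ℕ} {M : Type u} [TopologicalSpace M] [ChartedSpace (Euc n) M]
  {φ ψ : OpenPartialHomeomorph M (Euc n)} {H : CotangentBundle n M → ℝ}

/-- The gradient `∂H/∂xⁱ`. -/
def gradX (H : CotangentBundle n M → ℝ) (φ : OpenPartialHomeomorph M (Euc n)) (x : Euc n)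
    (p : Fin n → ℝ) : Fin n → ℝ := fun i => dx (localH H φ) i x p

/-- The gradient `∂H/∂pᵢ`. -/
def gradP (H : CotangentBundle n M → ℝ) (φ : OpenPartialHomeomorph M (Euc n)) (x : Euc n)
    (p : Fin n → ℝ) : Fin n → ℝ := fun i => dp (localH H φ) i x p

theorem Omega_eq (x : Euc n) (p : Fin n → ℝ) : Omega H φ x p = p ⬝ᵥ gradP H φ x p := rfl

theorem modV_eq (x : Euc n) (p : Fin n → ℝ) :
    modV H φ x p = (Omega H φ x p)⁻¹ • gradP H φ x p := by
  funext i
  exact div_eq_inv_mul _ _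

theorem modTheta_eq (x : Euc n) (p : Fin n → ℝ) :
    modTheta H φ x p = -((Omega H φ x p)⁻¹ • gradX H φ x p) := by
  funext i
  exact congrArg Neg.neg (div_eq_inv_mul _ _)

/-- The matrix `Σₖ pₖ Γᵏᵢⱼ`. -/
def gamM (Γ : SymmetricExtendedConnection n M) (φ : OpenPartialHomeomorph M (Euc n)) (x : Euc n)
    (p : Fin n → ℝ) : Matrix (Fin n) (Fin n) ℝ :=
  Matrix.of fun i j => ∑ k, p k * Γ.comp φ x p k i j

/-- The connection term of `∇ᵢH` is contracted with `∂H/∂p`, and division by `Ω` turns this into a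
contraction with the velocity. It is exactly the correction that distinguishes `∇ₜp` from `ṗ`. -/
theorem modQ_eq (Γ : SymmetricExtendedConnection n M) (x : Euc n) (p : Fin n → ℝ) :
    modQ H Γ φ x p = modTheta H φ x p - (gamM Γ φ x p).mulVec (modV H φ x p) := by
  funext i
  simp only [modQ, modTheta, modV, covDeriv, gamM, Matrix.mulVec, dotProduct, Matrix.of_apply,
    Pi.sub_apply, add_div, Finset.sum_div, Finset.sum_mul, neg_add, mul_div_assoc]
  rfl

theorem contDiffOn_localH [IsManifold (𝓡 n) ∞ M]
    (hH : ContMDiffOn (cotModel n) 𝓘(ℝ, ℝ) ∞ H {q | q.2 ≠ 0}) (hφ : IsChart φ) :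
    ContDiffOn ℝ ∞ (fun z : Euc n × (Fin n → ℝ) => localH H φ z.1 z.2) (coordDomain φ) := by
  rw [← contMDiffOn_iff_contDiffOn]
  exact hH.comp (hφ.contMDiffOn_ofCoords.mono fun z hz => ⟨hz.1, mem_univ _⟩)
    fun z hz => hφ.ofCoords_ne_zero hz

theorem localH_change (hφ : IsChart φ) (hψ : IsChart ψ) {x : Euc n} {p : Fin n → ℝ}
    (hx : x ∈ φ.target) (hs : φ.symm x ∈ ψ.source) :
    localH H ψ (changeX φ ψ x) (changeP φ ψ x p) = localH H φ x p :=
  congrArg H (ofCoords_change hφ hψ p hx hs)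

section Smooth

variable [IsManifold (𝓡 n) ∞ M]
  (hH : ContMDiffOn (cotModel n) 𝓘(ℝ, ℝ) ∞ H {q | q.2 ≠ 0})
include hH

theorem hasFDerivAt_localH (hφ : IsChart φ) {x : Euc n} {p : Fin n → ℝ}
    (h : (x, p) ∈ coordDomain φ) :
    HasFDerivAt (fun z : Euc n × (Fin n → ℝ) => localH H φ z.1 z.2)
      (fderiv ℝ (fun z : Euc n × (Fin n → ℝ) => localH H φ z.1 z.2) (x, p)) (x, p) :=
  (((contDiffOn_localH hH hφ).contDiffAt
    ((isOpen_coordDomain φ).mem_nhds h)).differentiableAt (by simp)).hasFDerivAt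

theorem contDiffOn_gradX (hφ : IsChart φ) :
    ContDiffOn ℝ ∞ (fun z : Euc n × (Fin n → ℝ) => gradX H φ z.1 z.2) (coordDomain φ) :=
  contDiffOn_pi.2 fun i => contDiffOn_dx (isOpen_coordDomain φ) (contDiffOn_localH hH hφ) i

theorem contDiffOn_gradP (hφ : IsChart φ) :
    ContDiffOn ℝ ∞ (fun z : Euc n × (Fin n → ℝ) => gradP H φ z.1 z.2) (coordDomain φ) :=
  contDiffOn_pi.2 fun i => contDiffOn_dp (isOpen_coordDomain φ) (contDiffOn_localH hH hφ) i

theorem contDiffOn_Omega (hφ : IsChart φ) :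
    ContDiffOn ℝ ∞ (fun z : Euc n × (Fin n → ℝ) => Omega H φ z.1 z.2) (coordDomain φ) := by
  refine ContDiffOn.sum fun i _ => ?_
  have h : ContDiffOn ℝ ∞ (fun z : Euc n × (Fin n → ℝ) => z.2 i) (coordDomain φ) :=
    ContDiff.contDiffOn (by fun_prop)
  exact h.mul (contDiffOn_pi.1 (contDiffOn_gradP hH hφ) i)

/-- The derivatives of `H` in two charts. -/
theorem grad_change (hφ : IsChart φ) (hψ : IsChart ψ) {x : Euc n} {p : Fin n → ℝ}
    (h : (x, p) ∈ coordOverlap φ ψ) :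
    gradP H φ x p =
      (jacM ψ φ (changeX φ ψ x)).mulVec (gradP H ψ (changeX φ ψ x) (changeP φ ψ x p)) ∧
    gradX H φ x p = (jacM φ ψ x).transpose.mulVec
      (gradX H ψ (changeX φ ψ x) (changeP φ ψ x p) +
        (hessM φ ψ x p).mulVec (gradP H ψ (changeX φ ψ x) (changeP φ ψ x p))) := by
  have hx := h.1.1
  have hs := h.2
  have hD := hasFDerivAt_localH hH hψ (change_mem_coordDomain hφ hψ h)
  set D := fderiv ℝ (fun z : Euc n × (Fin n → ℝ) => localH H ψ z.1 z.2)
    (changeX φ ψ x, changeP φ ψ x p)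
  obtain ⟨L, hL, hLe⟩ := hasFDerivAt_changeP hφ hψ p hx hs
  have hX : HasFDerivAt (fun z : Euc n × (Fin n → ℝ) => changeX φ ψ z.1)
      ((fderiv ℝ (changeX φ ψ) x).comp (ContinuousLinearMap.fst ℝ _ _)) (x, p) :=
    HasFDerivAt.comp (x, p) (g := changeX φ ψ) (f := Prod.fst)
      ((contDiffAt_changeX hφ hψ hx hs).differentiableAt (by simp)).hasFDerivAt hasFDerivAt_fst
  have hcomp := HasFDerivAt.comp (x, p) hD (hX.prodMk hL)
  -- Near `(x, p)` the function `H` in the chart `φ` is `H` in the chart `ψ` composed with the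
  -- change of coordinates; both gradient formulas are read off from the derivative of this
  -- identity.
  have hloc : HasFDerivAt (fun z : Euc n × (Fin n → ℝ) => localH H φ z.1 z.2)
      (D.comp (((fderiv ℝ (changeX φ ψ) x).comp (ContinuousLinearMap.fst ℝ _ _)).prod L))
      (x, p) := by
    refine hcomp.congr_of_eventuallyEq ?_
    filter_upwards [((isOpen_overlap φ ψ).preimage continuous_fst).mem_nhds
      (show (x, p) ∈ _ from ⟨hx, hs⟩)] with z hz
    exact (localH_change hφ hψ hz.1 hz.2).symm
  have hT : ∀ u : Euc n, (fderiv ℝ (changeX φ ψ) x u : Fin n → ℝ) = (jacM φ ψ x).mulVec u :=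
    fun u => funext fun i => fderiv_changeX_apply x u i
  constructor
  · funext i
    change dp (localH H φ) i x p = _
    rw [dp_eq hloc]
    change D (fderiv ℝ (changeX φ ψ) x 0, L (0, Pi.single i 1)) = _
    rw [fderiv_eq_dotProduct hD, hLe, map_zero]
    change (0 : Fin n → ℝ) ⬝ᵥ _ + (_ + _) ⬝ᵥ gradP H ψ _ _ = _
    simp only [WithLp.ofLp_zero, Matrix.mulVec_zero, zero_add, zero_dotProduct]
    rw [Matrix.mulVec_transpose, ← Matrix.dotProduct_mulVec, single_one_dotProduct]
  · funext i
    change dx (localH H φ) i x p = _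
    rw [dx_eq hloc]
    change D (fderiv ℝ (changeX φ ψ) x (EuclideanSpace.single i 1),
      L (EuclideanSpace.single i 1, 0)) = _
    rw [fderiv_eq_dotProduct hD, hLe, hT]
    change _ ⬝ᵥ gradX H ψ _ _ + (_ + _) ⬝ᵥ gradP H ψ _ _ = _
    rw [Matrix.mulVec_zero, add_zero]
    have h1 : ∀ v w : Fin n → ℝ, (hessM φ ψ x p).mulVec v ⬝ᵥ w =
        v ⬝ᵥ (hessM φ ψ x p).mulVec w := fun v w => by
      conv_lhs => rw [← hessM_transpose hφ hψ p hx hs]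
      rw [Matrix.mulVec_transpose, Matrix.dotProduct_mulVec]
    have h2 : ∀ v w : Fin n → ℝ, (jacM φ ψ x).mulVec v ⬝ᵥ w =
        v ⬝ᵥ (jacM φ ψ x).transpose.mulVec w := fun v w => by
      rw [Matrix.dotProduct_mulVec, Matrix.vecMul_transpose]
    rw [h1, ← dotProduct_add, h2]
    exact single_one_dotProduct _ _

theorem Omega_change (hφ : IsChart φ) (hψ : IsChart ψ) {x : Euc n} {p : Fin n → ℝ}
    (h : (x, p) ∈ coordOverlap φ ψ) :
    Omega H ψ (changeX φ ψ x) (changeP φ ψ x p) = Omega H φ x p := by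
  rw [Omega_eq, Omega_eq, (grad_change hH hφ hψ h).1, changeP_eq, Matrix.dotProduct_mulVec,
    Matrix.mulVec_transpose]

theorem modV_change (hφ : IsChart φ) (hψ : IsChart ψ) {x : Euc n} {p : Fin n → ℝ}
    (h : (x, p) ∈ coordOverlap φ ψ) :
    modV H ψ (changeX φ ψ x) (changeP φ ψ x p) = (jacM φ ψ x).mulVec (modV H φ x p) := by
  rw [modV_eq, modV_eq, Omega_change hH hφ hψ h, (grad_change hH hφ hψ h).1, Matrix.mulVec_smul,
    Matrix.mulVec_mulVec, jacM_mul_jacM' hφ hψ h.1.1 h.2, Matrix.one_mulVec]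

/-- The Hessian term in the law for `∂H/∂x` becomes, after division by `-Ω`, the Hessian matrix
applied to the velocity. This is the inhomogeneous term by which the rate of change of momentum
fails to be a covector. -/
theorem modTheta_change (hφ : IsChart φ) (hψ : IsChart ψ) {x : Euc n} {p : Fin n → ℝ}
    (h : (x, p) ∈ coordOverlap φ ψ) :
    modTheta H ψ (changeX φ ψ x) (changeP φ ψ x p) =
      (hessM φ ψ x p).mulVec ((jacM φ ψ x).mulVec (modV H φ x p)) +
        (jacM ψ φ (changeX φ ψ x)).transpose.mulVec (modTheta H φ x p) := by
  rw [← modV_change hH hφ hψ h, modTheta_eq, modTheta_eq, modV_eq, Omega_change hH hφ hψ h,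
    (grad_change hH hφ hψ h).2, Matrix.mulVec_neg, Matrix.mulVec_smul, Matrix.mulVec_smul,
    Matrix.mulVec_mulVec, ← Matrix.transpose_mul, jacM_mul_jacM' hφ hψ h.1.1 h.2,
    Matrix.transpose_one, Matrix.one_mulVec, smul_add]
  abel

end Smooth

theorem sum_reverse₃ {α : Type*} [Fintype α] (f : α → α → α → ℝ) :
    ∑ a, ∑ b, ∑ c, f a b c = ∑ c, ∑ b, ∑ a, f a b c := by
  rw [Finset.sum_congr rfl fun a _ => Finset.sum_comm, Finset.sum_comm]
  exact Finset.sum_congr rfl fun c _ => Finset.sum_comm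

theorem sum_reverse₄ {α : Type*} [Fintype α] (f : α → α → α → α → ℝ) :
    ∑ a, ∑ b, ∑ c, ∑ d, f a b c d = ∑ d, ∑ c, ∑ b, ∑ a, f a b c d := by
  rw [Finset.sum_congr rfl fun a _ => sum_reverse₃ (f a), Finset.sum_comm]
  refine Finset.sum_congr rfl fun d _ => ?_
  rw [Finset.sum_comm]
  exact Finset.sum_congr rfl fun c _ => Finset.sum_comm

/-- The inhomogeneous term of the connection contains derivatives of `∂x̃/∂x`. Differentiating
`(∂x/∂x̃)(∂x̃/∂x) = 1` replaces them by derivatives of `∂x/∂x̃`, which assemble to `-hessM` after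
contraction with `p`. -/
theorem gamM_change (Γ : SymmetricExtendedConnection n M) (hφ : IsChart φ) (hψ : IsChart ψ)
    {x : Euc n} {p : Fin n → ℝ} (h : (x, p) ∈ coordOverlap φ ψ) :
    gamM Γ φ x p = (jacM φ ψ x).transpose *
      (gamM Γ ψ (changeX φ ψ x) (changeP φ ψ x p) - hessM φ ψ x p) * jacM φ ψ x := by
  have hx := h.1.1
  have hs := h.2
  have hrel : ∀ i j k, ∑ m, jac ψ φ (changeX φ ψ x) k m *
      fderiv ℝ (fun z => jac φ ψ z m i) x (EuclideanSpace.single j 1) =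
      -∑ m, ∑ b, fderiv ℝ (fun y => jac ψ φ y k m) (changeX φ ψ x) (EuclideanSpace.single b 1) *
        jac φ ψ x b j * jac φ ψ x m i := by
    intro i j k
    have hS : ∀ m, HasFDerivAt (fun z => jac ψ φ (changeX φ ψ z) k m) _ x := fun m =>
      HasFDerivAt.comp x (g := fun y => jac ψ φ y k m) (f := changeX φ ψ)
        ((contDiffAt_jac hψ hφ (changeX_mem hs)
          (symm_changeX_mem hx hs) k m).differentiableAt (by simp)).hasFDerivAt
        ((contDiffAt_changeX hφ hψ hx hs).differentiableAt (by simp)).hasFDerivAt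
    have hT : ∀ m, HasFDerivAt (fun z => jac φ ψ z m i) _ x := fun m =>
      ((contDiffAt_jac hφ hψ hx hs m i).differentiableAt (by simp)).hasFDerivAt
    have h1 := HasFDerivAt.fun_sum (u := Finset.univ) fun m _ => (hS m).mul (hT m)
    have h2 : HasFDerivAt (fun z => ∑ m, ((fun z => jac ψ φ (changeX φ ψ z) k m) *
        fun z => jac φ ψ z m i) z) (0 : Euc n →L[ℝ] ℝ) x := by
      refine (hasFDerivAt_const (if k = i then (1 : ℝ) else 0) x).congr_of_eventuallyEq ?_
      filter_upwards [(isOpen_overlap φ ψ).mem_nhds ⟨hx, hs⟩] with z hz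
      exact sum_jac_mul_jac hφ hψ hz.1 hz.2 k i
    have h3 := congrArg (fun L : Euc n →L[ℝ] ℝ => L (EuclideanSpace.single j (1 : ℝ)))
      (h1.unique h2)
    simp only [_root_.sum_apply, _root_.add_apply, _root_.smul_apply, smul_eq_mul,
      ContinuousLinearMap.comp_apply, _root_.zero_apply, Finset.sum_add_distrib] at h3
    rw [eq_neg_iff_add_eq_zero, ← h3]
    congr 1
    refine Finset.sum_congr rfl fun m _ => ?_
    rw [euc_eq_sum (fderiv ℝ (changeX φ ψ) x (EuclideanSpace.single j 1)), map_sum,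
      Finset.mul_sum]
    refine Finset.sum_congr rfl fun b _ => ?_
    rw [map_smul, smul_eq_mul]
    change _ = _ * (jac φ ψ x b j * _)
    ring
  ext i j
  have e1 : gamM Γ φ x p i j = (∑ k, p k * ∑ m, ∑ a, ∑ c, jac ψ φ (changeX φ ψ x) k m *
      jac φ ψ x a i * jac φ ψ x c j * Γ.comp ψ (changeX φ ψ x) (changeP φ ψ x p) m a c) +
      ∑ k, p k * -∑ m, ∑ b, fderiv ℝ (fun y => jac ψ φ y k m) (changeX φ ψ x)
        (EuclideanSpace.single b 1) * jac φ ψ x b j * jac φ ψ x m i := by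
    rw [← Finset.sum_add_distrib]
    simp only [gamM, Matrix.of_apply]
    refine Finset.sum_congr rfl fun k _ => ?_
    rw [← mul_add, ← hrel, ← Γ.transform φ ψ hφ hψ x p h]
  have e2 : ∀ A B : Matrix (Fin n) (Fin n) ℝ, ((jacM φ ψ x).transpose * (A - B) * jacM φ ψ x) i j =
      (∑ c, ∑ a, jac φ ψ x a i * A a c * jac φ ψ x c j) -
        ∑ c, ∑ a, jac φ ψ x a i * B a c * jac φ ψ x c j := by
    intro A B
    rw [Matrix.mul_sub, Matrix.sub_mul, Matrix.sub_apply]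
    simp only [Matrix.mul_apply, Finset.sum_mul]
    rfl
  rw [e1, e2, sub_eq_add_neg]
  congr 1
  · simp only [gamM, Matrix.of_apply, changeP, Finset.mul_sum, Finset.sum_mul]
    rw [sum_reverse₄]
    exact Finset.sum_congr rfl fun c _ => Finset.sum_congr rfl fun a _ =>
      Finset.sum_congr rfl fun m _ => Finset.sum_congr rfl fun k _ => by ring
  · simp only [hessM, Matrix.of_apply, mul_neg, Finset.sum_neg_distrib, Finset.mul_sum,
      Finset.sum_mul]
    rw [sum_reverse₃]
    exact congrArg Neg.neg (Finset.sum_congr rfl fun c _ => Finset.sum_congr rfl fun a _ =>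
      Finset.sum_congr rfl fun k _ => by ring)

section System

variable [IsManifold (𝓡 n) ∞ M]
  (hH : ContMDiffOn (cotModel n) 𝓘(ℝ, ℝ) ∞ H {q | q.2 ≠ 0})
  (hΩ : ∀ φ : OpenPartialHomeomorph M (Euc n), IsChart φ →
    ∀ x p, (x, p) ∈ coordDomain φ → Omega H φ x p ≠ 0)
include hH

theorem fderiv_changeP_modTheta (hφ : IsChart φ) (hψ : IsChart ψ) {x : Euc n}
    {p : Fin n → ℝ} (h : (x, p) ∈ coordOverlap φ ψ) :
    fderiv ℝ (fun z : Euc n × (Fin n → ℝ) => changeP φ ψ z.1 z.2) (x, p)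
      (WithLp.toLp 2 (modV H φ x p), modTheta H φ x p) =
      modTheta H ψ (changeX φ ψ x) (changeP φ ψ x p) := by
  obtain ⟨L, hL, hLe⟩ := hasFDerivAt_changeP hφ hψ p h.1.1 h.2
  rw [hL.fderiv, hLe, modTheta_change hH hφ hψ h]

/-- The Hessian terms contributed by `modTheta_change` and `gamM_change` cancel, which leaves the
law of a covector. -/
theorem modQ_change (Γ : SymmetricExtendedConnection n M) (hφ : IsChart φ) (hψ : IsChart ψ)
    {x : Euc n} {p : Fin n → ℝ} (h : (x, p) ∈ coordOverlap φ ψ) :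
    modQ H Γ ψ (changeX φ ψ x) (changeP φ ψ x p) =
      (jacM ψ φ (changeX φ ψ x)).transpose.mulVec (modQ H Γ φ x p) := by
  rw [modQ_eq, modQ_eq, modTheta_change hH hφ hψ h, modV_change hH hφ hψ h,
    gamM_change Γ hφ hψ h, Matrix.mulVec_sub, Matrix.mulVec_mulVec _ _ (_ * _),
    ← Matrix.mul_assoc, ← Matrix.mul_assoc, ← Matrix.transpose_mul,
    jacM_mul_jacM' hφ hψ h.1.1 h.2, Matrix.transpose_one, Matrix.one_mul,
    ← Matrix.mulVec_mulVec, Matrix.sub_mulVec]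
  abel

include hΩ

theorem smoothComponents_modV : SmoothComponents (modV H) := fun φ hφ => by
  have h := ((contDiffOn_Omega hH hφ).inv fun z hz => hΩ φ hφ z.1 z.2 hz).smul
    (contDiffOn_gradP hH hφ)
  exact h.congr fun z _ => modV_eq z.1 z.2

theorem smoothComponents_modTheta : SmoothComponents (modTheta H) := fun φ hφ => by
  have h := (((contDiffOn_Omega hH hφ).inv fun z hz => hΩ φ hφ z.1 z.2 hz).smul
    (contDiffOn_gradX hH hφ)).neg
  exact h.congr fun z _ => modTheta_eq z.1 z.2

theorem smoothComponents_modQ (Γ : SymmetricExtendedConnection n M) :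
    SmoothComponents (modQ H Γ) := fun φ hφ => by
  have h : ContDiffOn ℝ ∞ (fun z : Euc n × (Fin n → ℝ) =>
      (gamM Γ φ z.1 z.2).mulVec (modV H φ z.1 z.2)) (coordDomain φ) := by
    refine contDiffOn_pi.2 fun i => ?_
    change ContDiffOn ℝ ∞ (fun z : Euc n × (Fin n → ℝ) => ∑ j, (∑ k, z.2 k *
      Γ.comp φ z.1 z.2 k i j) * modV H φ z.1 z.2 j) (coordDomain φ)
    refine ContDiffOn.sum fun j _ => ?_
    refine ContDiffOn.mul (ContDiffOn.sum fun k _ => ContDiffOn.mul ?_ (Γ.smooth φ hφ k i j))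
      (contDiffOn_pi.1 (smoothComponents_modV hH hΩ φ hφ) j)
    exact ContDiff.contDiffOn (by fun_prop)
  exact ((smoothComponents_modTheta hH hΩ φ hφ).sub h).congr fun z _ => modQ_eq Γ z.1 z.2

theorem isExtendedVectorField_modV : IsExtendedVectorField (modV H) :=
  ⟨smoothComponents_modV hH hΩ, fun _ _ hφ hψ _ _ h i => congrFun (modV_change hH hφ hψ h) i⟩

theorem isExtendedCovectorField_modQ (Γ : SymmetricExtendedConnection n M) :
    IsExtendedCovectorField (modQ H Γ) :=
  ⟨smoothComponents_modQ hH hΩ Γ, fun _ _ hφ hψ _ _ h i => congrFun (modQ_change hH Γ hφ hψ h) i⟩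

theorem isNewtonianSystem_modified : IsNewtonianSystem (modV H) (modTheta H) :=
  ⟨isExtendedVectorField_modV hH hΩ, smoothComponents_modTheta hH hΩ, fun _ _ hφ hψ _ _ h =>
    (fderiv_changeP_modTheta hH hφ hψ h).symm⟩

end System

/-- The covariant and the coordinate form of the modified Hamiltonian system have the same
trajectories. -/
theorem isCovTrajectory_eq_isTrajectory [IsManifold (𝓡 n) ∞ M]
    (Γ : SymmetricExtendedConnection n M) :
    IsCovTrajectory Γ (modV H) (modQ H Γ) = IsTrajectory (modV H) (modTheta H) := by
  funext J γ
  refine propext (and_congr_right fun _ => forall₂_congr fun t _ => and_congr_right fun _ =>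
    forall₃_congr fun φ _ _ => ?_)
  have hN : ∀ v : Fin n → ℝ, ∀ i, (∑ j, ∑ k, Γ.comp φ (φ (γ t).proj) (momentum φ (γ t)) k i j *
      momentum φ (γ t) k * v j) =
      (gamM Γ φ (φ (γ t).proj) (momentum φ (γ t))).mulVec v i := fun v i => by
    simp only [Matrix.mulVec, dotProduct, gamM, Matrix.of_apply, Finset.sum_mul]
    exact Finset.sum_congr rfl fun j _ => Finset.sum_congr rfl fun k _ => by ring
  constructor
  · rintro ⟨x', p', hx, hp, hxV, hpQ⟩ i
    -- Once the velocity is known to be `V`, the correction in `∇ₜp` is the term that `modQ_eq`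
    -- subtracts from `Θ`.
    obtain rfl : x' = modV H φ (φ (γ t).proj) (momentum φ (γ t)) := funext hxV
    refine ⟨hx i, ?_⟩
    have h := hpQ i
    rw [hN, modQ_eq, Pi.sub_apply, sub_left_inj] at h
    exact h ▸ hp i
  · intro h
    refine ⟨_, _, fun i => (h i).1, fun i => (h i).2, fun i => rfl, fun i => ?_⟩
    rw [hN, modQ_eq, Pi.sub_apply]

end Hamiltonian

/-! ### Normality of shifts -/

section Calculus

variable {n : ℕ}

theorem hasDerivAt_euc {f : ℝ → Euc n} {f' : Fin n → ℝ} {t : ℝ}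
    (h : ∀ i, HasDerivAt (fun s => f s i) (f' i) t) : HasDerivAt f (WithLp.toLp 2 f') t :=
  (EuclideanSpace.equiv (Fin n) ℝ).symm.hasFDerivAt.comp_hasDerivAt t (hasDerivAt_pi.2 h)

/-- If the momentum has the value `1` on the velocity and the symplectic form vanishes on the
velocity and the variation, the momentum on the variation does not depend on time. -/
theorem hasDerivAt_momentum_variation {X : ℝ × ℝ → Euc n} {P : ℝ × ℝ → Fin n → ℝ} {t₀ : ℝ}
    (hX : ContDiffAt ℝ ∞ X (t₀, 0)) (hP : ContDiffAt ℝ ∞ P (t₀, 0))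
    (h1 : ∀ᶠ w in 𝓝 (t₀, (0 : ℝ)), P w ⬝ᵥ fderiv ℝ X w (1, 0) = 1)
    (h2 : fderiv ℝ P (t₀, 0) (1, 0) ⬝ᵥ fderiv ℝ X (t₀, 0) (0, 1) =
      fderiv ℝ P (t₀, 0) (0, 1) ⬝ᵥ fderiv ℝ X (t₀, 0) (1, 0)) :
    HasDerivAt (fun t => P (t, 0) ⬝ᵥ fderiv ℝ X (t, 0) (0, 1)) 0 t₀ := by
  have hPd := (hP.differentiableAt (by simp)).hasFDerivAt
  have hXd : HasFDerivAt (fderiv ℝ X) (fderiv ℝ (fderiv ℝ X) (t₀, 0)) (t₀, 0) :=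
    ((hX.fderiv_right (m := ∞) (by simp)).differentiableAt (by simp)).hasFDerivAt
  have hB : ∀ v : ℝ × ℝ, ∃ L : ℝ × ℝ →L[ℝ] ℝ,
      HasFDerivAt (fun w => P w ⬝ᵥ fderiv ℝ X w v) L (t₀, 0) ∧ ∀ u, L u =
        fderiv ℝ P (t₀, 0) u ⬝ᵥ fderiv ℝ X (t₀, 0) v +
          P (t₀, 0) ⬝ᵥ fderiv ℝ (fderiv ℝ X) (t₀, 0) u v := by
    intro v
    have hXi : ∀ i : Fin n, HasFDerivAt (fun w => fderiv ℝ X w v i)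
        ((EuclideanSpace.proj i : Euc n →L[ℝ] ℝ).comp
          ((fderiv ℝ (fderiv ℝ X) (t₀, 0)).flip v)) (t₀, 0) := fun i => by
      have h : HasFDerivAt (fun w => fderiv ℝ X w v)
          ((fderiv ℝ (fderiv ℝ X) (t₀, 0)).flip v) (t₀, 0) := by
        simpa using hXd.clm_apply (hasFDerivAt_const v _)
      exact (EuclideanSpace.proj i : Euc n →L[ℝ] ℝ).hasFDerivAt.comp _ h
    have hPi := hasFDerivAt_pi'.1 hPd
    refine ⟨_, HasFDerivAt.fun_sum (u := Finset.univ) fun i _ => (hPi i).mul (hXi i), fun u => ?_⟩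
    simp only [_root_.sum_apply, _root_.add_apply, _root_.smul_apply, smul_eq_mul,
      Finset.sum_add_distrib, dotProduct]
    rw [add_comm]
    congr 1
    exact Finset.sum_congr rfl fun i _ => mul_comm _ _
  obtain ⟨L₁, hL₁, e₁⟩ := hB (1, 0)
  obtain ⟨L₂, hL₂, e₂⟩ := hB (0, 1)
  have hL₁0 : L₁ = 0 := hL₁.unique ((hasFDerivAt_const (1 : ℝ) _).congr_of_eventuallyEq h1)
  have hsymm := (hX.isSymmSndFDerivAt (by
    simpa using (mod_cast le_top : ((2 : ℕ∞) : ℕ∞ω) ≤ ((⊤ : ℕ∞) : ℕ∞ω)))).eq (1, 0) (0, 1)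
  -- By `h2` and the symmetry of second derivatives, the time derivative of `P ⬝ᵥ X_s` equals the
  -- `s`-derivative of `P ⬝ᵥ X_t`, a function constantly equal to `1`.
  have hzero : L₂ (1, 0) = 0 := by
    rw [e₂, h2, hsymm, ← e₁, hL₁0]
    rfl
  have h3 := hL₂.comp_hasDerivAt_of_eq t₀
    ((hasDerivAt_id t₀).prodMk (hasDerivAt_const t₀ (0 : ℝ))) rfl
  rw [hzero] at h3
  exact h3

end Calculus

/-! ### Energy and the symplectic form along trajectories -/

section Trajectories

variable {n : ℕ} {M : Type u} [TopologicalSpace M] [ChartedSpace (Euc n) M]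
  [IsManifold (𝓡 n) ∞ M] {φ ψ : OpenPartialHomeomorph M (Euc n)} {H : CotangentBundle n M → ℝ}

theorem isChart_chartAt (x : M) : IsChart (chartAt (Euc n) x) :=
  IsManifold.chart_mem_maximalAtlas x

omit [IsManifold (𝓡 n) ∞ M] in
theorem modV_dotProduct (x : Euc n) (p : Fin n → ℝ) (h : Omega H φ x p ≠ 0) :
    p ⬝ᵥ modV H φ x p = 1 := by
  rw [modV_eq, dotProduct_smul, ← Omega_eq, smul_eq_mul, inv_mul_cancel₀ h]

omit [IsManifold (𝓡 n) ∞ M] in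
-- Contracting the symplectic form with the modified field gives `-Ω⁻¹ dH`; `(u, w)` is an arbitrary
-- variation of `(x, p)`.
theorem modTheta_symplectic (x : Euc n) (p u w : Fin n → ℝ) :
    modTheta H φ x p ⬝ᵥ u - w ⬝ᵥ modV H φ x p =
      -((Omega H φ x p)⁻¹ * (u ⬝ᵥ gradX H φ x p + w ⬝ᵥ gradP H φ x p)) := by
  rw [modTheta_eq, modV_eq, neg_dotProduct, smul_dotProduct, dotProduct_smul, dotProduct_comm u]
  simp only [smul_eq_mul]
  ring

theorem eventually_mem_source {γ : ℝ → CotangentBundle n M} {t : ℝ} (hγ : ContinuousAt γ t)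
    (h : (γ t).proj ∈ φ.source) : ∀ᶠ s in 𝓝 t, (γ s).proj ∈ φ.source := by
  have hp : Continuous (fun q : CotangentBundle n M => q.proj) := contMDiff_cotangent_proj.continuous
  exact (hp.continuousAt.comp hγ).eventually (φ.open_source.mem_nhds h)

theorem hasDerivAt_coords {V Θ : LocalComponents n M} {J : Set ℝ} {γ : ℝ → CotangentBundle n M}
    (hγ : IsTrajectory V Θ J γ) {t : ℝ} (ht : t ∈ J) (hφ : IsChart φ)
    (h : (γ t).proj ∈ φ.source) :
    HasDerivAt (fun s => coords φ (γ s)) (WithLp.toLp 2 (V φ (φ (γ t).proj) (momentum φ (γ t))),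
      Θ φ (φ (γ t).proj) (momentum φ (γ t))) t := by
  have h1 := (hγ.2 t ht).2 φ hφ h
  exact (hasDerivAt_euc fun i => (h1 i).1).prodMk (hasDerivAt_pi.2 fun i => (h1 i).2)

/-- The Hamilton function is constant along the trajectories of the modified system. -/
theorem hamiltonian_eq (hH : ContMDiffOn (cotModel n) 𝓘(ℝ, ℝ) ∞ H {q | q.2 ≠ 0}) {J : Set ℝ}
    (hJ : IsOpen J) (hJc : J.OrdConnected) {γ : ℝ → CotangentBundle n M}
    (hγ : IsTrajectory (modV H) (modTheta H) J γ) {s t : ℝ} (hs : s ∈ J) (ht : t ∈ J) :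
    H (γ s) = H (γ t) := by
  have key : ∀ t ∈ J, HasDerivAt (fun s => H (γ s)) 0 t := by
    intro t ht
    have hφ := isChart_chartAt (n := n) (γ t).proj
    set φ := chartAt (Euc n) (γ t).proj
    have hsrc : (γ t).proj ∈ φ.source := mem_chart_source _ _
    have hD := hasFDerivAt_localH hH hφ (hφ.coords_mem hsrc (hγ.2 t ht).1)
    have h1 := hD.comp_hasDerivAt_of_eq t (hasDerivAt_coords hγ ht hφ hsrc) rfl
    rw [fderiv_eq_dotProduct hD] at h1
    have h2 := modTheta_symplectic (H := H) (φ := φ) (φ (γ t).proj) (momentum φ (γ t))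
      (modV H φ (φ (γ t).proj) (momentum φ (γ t))) (modTheta H φ (φ (γ t).proj) (momentum φ (γ t)))
    -- The derivative of `H` along the field: both terms are `±Ω⁻¹ (∂H/∂x · ∂H/∂p)`.
    have h3 : modV H φ (φ (γ t).proj) (momentum φ (γ t)) ⬝ᵥ
        gradX H φ (φ (γ t).proj) (momentum φ (γ t)) +
        modTheta H φ (φ (γ t).proj) (momentum φ (γ t)) ⬝ᵥ
        gradP H φ (φ (γ t).proj) (momentum φ (γ t)) = 0 := by
      rw [modV_eq, modTheta_eq, smul_dotProduct, neg_dotProduct, smul_dotProduct,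
        dotProduct_comm (gradP H φ _ _), add_neg_cancel]
    have h4 := h1.congr_deriv h3
    refine h4.congr_of_eventuallyEq ?_
    filter_upwards [eventually_mem_source (hγ.1.continuousAt (hJ.mem_nhds ht)) hsrc] with s hs
    exact (congrArg H (hφ.ofCoords_momentum hs)).symm
  exact hJ.is_const_of_deriv_eq_zero hJc.isPreconnected
    (fun t ht => (key t ht).differentiableAt.differentiableWithinAt)
    (fun t ht => (key t ht).deriv) hs ht

end Trajectories

/-! ### Normality of shifts of constant energy -/

section Normality

variable {d : ℕ} {N : Type u} [TopologicalSpace N] [ChartedSpace (Euc (d + 1)) N]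
  [IsManifold (𝓡 (d + 1)) ∞ N] {S : Type u} [TopologicalSpace S] [ChartedSpace (Euc d) S]

/-- A straight line in a chart. Representing `τ` by a curve reduces normality to families with one
time and one real parameter. -/
theorem exists_curve [IsManifold (𝓡 d) ∞ S] (y : S) (τ : TangentSpace (𝓡 d) y) :
    ∃ c : ℝ → S, ContMDiffAt 𝓘(ℝ, ℝ) (𝓡 d) ∞ c 0 ∧ c 0 = y ∧
      (mfderiv 𝓘(ℝ, ℝ) (𝓡 d) c 0 (1 : ℝ) : Euc d) = τ := by
  have hχ : IsChart (chartAt (Euc d) y) := isChart_chartAt y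
  set χ := chartAt (Euc d) y
  have hy : y ∈ χ.source := mem_chart_source _ _
  set v : Euc d := chartDeriv χ y τ
  let l : ℝ → Euc d := fun s => χ y + s • v
  have hl : HasDerivAt l v 0 := by
    have h := ((hasDerivAt_id (0 : ℝ)).smul_const v).const_add (χ y)
    rw [one_smul] at h
    exact h
  have hl0 : l 0 = χ y := by simp [l]
  have hlm : ContMDiffAt 𝓘(ℝ, ℝ) (𝓡 d) ∞ l 0 := by
    refine ContDiffAt.contMDiffAt ?_
    fun_prop
  have hs := hχ.contMDiffAt_symm (χ.map_source hy)
  refine ⟨χ.symm ∘ l, ?_, ?_, ?_⟩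
  · exact ContMDiffAt.comp (0 : ℝ) (by rw [hl0]; exact hs) hlm
  · simp [hl0, χ.left_inv hy]
  · have h1 := mfderiv_comp_of_eq (x := (0 : ℝ)) (hs.mdifferentiableAt (by simp))
      (hlm.mdifferentiableAt (by simp)) hl0
    have h2 : (mfderiv 𝓘(ℝ, ℝ) (𝓡 d) l 0 : ℝ →L[ℝ] Euc d) 1 = v := by
      rw [mfderiv_eq_fderiv]
      exact fderiv_apply_one_eq_deriv.trans hl.deriv
    have h3 := congrArg (fun L : Euc d →L[ℝ] Euc d => L τ) (hχ.mdifferentiable.symm_comp_deriv hy)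
    have h4 : (mfderiv (𝓡 d) (𝓡 d) χ.symm (l 0) : Euc d →L[ℝ] Euc d) =
        mfderiv (𝓡 d) (𝓡 d) χ.symm (χ y) := by rw [hl0]
    exact (congrArg (fun L : ℝ →L[ℝ] Euc d => L 1) h1).trans
      ((congrArg (mfderiv (𝓡 d) (𝓡 d) χ.symm (l 0) : Euc d →L[ℝ] Euc d) h2).trans
        ((congrArg (fun L : Euc d →L[ℝ] Euc d => L v) h4).trans h3))

omit [IsManifold (𝓡 (d + 1)) ∞ N] in
theorem hasDerivAt_chart_curve {φ : OpenPartialHomeomorph N (Euc (d + 1))} (hφ : IsChart φ) {c : ℝ → S}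
    (hc : MDifferentiableAt 𝓘(ℝ, ℝ) (𝓡 d) c 0) {f : S → N}
    (hf : MDifferentiableAt (𝓡 d) (𝓡 (d + 1)) f (c 0)) (hs : f (c 0) ∈ φ.source) :
    HasDerivAt (fun s => φ (f (c s))) (chartDeriv φ (f (c 0)) (mfderiv (𝓡 d) (𝓡 (d + 1)) f (c 0)
      (mfderiv 𝓘(ℝ, ℝ) (𝓡 d) c 0 (1 : ℝ)))) 0 := by
  have h1 := ((hφ.mdifferentiable.mdifferentiableAt hs).hasMFDerivAt.comp (c 0)
    hf.hasMFDerivAt).comp (0 : ℝ) hc.hasMFDerivAt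
  have h2 : HasFDerivAt (𝕜 := ℝ) (E := ℝ) (F := Euc (d + 1)) (fun s => φ (f (c s))) _ 0 :=
    h1.hasFDerivAt
  exact h2.hasDerivAt

/-- Shifts along the trajectories of the modified Hamiltonian system whose initial data have
constant energy are normal. -/
theorem shiftIsNormal [IsManifold (𝓡 d) ∞ S] {H : CotangentBundle (d + 1) N → ℝ}
    (hH : ContMDiffOn (cotModel (d + 1)) 𝓘(ℝ, ℝ) ∞ H {q | q.2 ≠ 0})
    (hΩ : ∀ φ : OpenPartialHomeomorph N (Euc (d + 1)), IsChart φ →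
      ∀ x p, (x, p) ∈ coordDomain φ → Omega H φ x p ≠ 0)
    {ι : S → N} {nu : ∀ y, TangentSpace (𝓡 (d + 1)) (ι y) →L[ℝ] ℝ} {ν : S → ℝ}
    (hnu : IsNormalCovectorField ι nu) {J : Set ℝ} {O : Set S}
    {q : ℝ → S → CotangentBundle (d + 1) N} {e : ℝ}
    (he : ∀ y ∈ O, H ⟨ι y, ν y • nu y⟩ = e)
    (hq : IsShift (IsTrajectory (modV H) (modTheta H)) ι nu ν J O q) : ShiftIsNormal J O q := by
  intro t ht y hy τ
  have hHe : ∀ t ∈ J, ∀ y ∈ O, H (q t y) = e := fun t ht y hy => by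
    rw [hamiltonian_eq hH hq.isOpen_time hq.interval_time (hq.trajectory y hy) ht hq.zero_mem,
      hq.initial y hy, he y hy]
  have hqs : ∀ t ∈ J, ∀ y ∈ O, ContMDiffAt (𝓘(ℝ, ℝ).prod (𝓡 d)) (cotModel (d + 1)) ∞
      (fun z : ℝ × S => q z.1 z.2) (t, y) := fun t ht y hy =>
    hq.smooth.contMDiffAt ((hq.isOpen_time.prod hq.isOpen_part).mem_nhds ⟨ht, hy⟩)
  have hdisp : ∀ t ∈ J, ∀ y ∈ O, MDifferentiableAt (𝓡 d) (𝓡 (d + 1)) (displacement q t) y :=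
    fun t ht y hy => by
      have h1 : ContMDiffAt (𝓡 d) (𝓘(ℝ, ℝ).prod (𝓡 d)) ∞ (fun y' : S => (t, y')) y :=
        contMDiffAt_const.prodMk contMDiffAt_id
      have h2 : ContMDiffAt (𝓡 d) (𝓡 (d + 1)) ∞ (displacement q t) y :=
        contMDiff_cotangent_proj.contMDiffAt.comp y ((hqs t ht y hy).comp y h1)
      exact h2.mdifferentiableAt (by simp)
  obtain ⟨c, hc, rfl, hcτ⟩ := exists_curve y τ
  have hcd : MDifferentiableAt 𝓘(ℝ, ℝ) (𝓡 d) c 0 := hc.mdifferentiableAt (by simp)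
  let g : ℝ → ℝ := fun t => (q t (c 0)).2 (mfderiv (𝓡 d) (𝓡 (d + 1)) (displacement q t) (c 0) τ)
  -- Vanishing of the derivative is local, so a chart around the position at time `t₀` suffices; the
  -- trajectory need not stay in one chart.
  have hg : ∀ t ∈ J, HasDerivAt g 0 t := by
    intro t₀ ht₀
    have hφ := isChart_chartAt (n := d + 1) (q t₀ (c 0)).proj
    set φ := chartAt (Euc (d + 1)) (q t₀ (c 0)).proj
    have hsrc : (q t₀ (c 0)).proj ∈ φ.source := mem_chart_source _ _
    let Q : ℝ × ℝ → CotangentBundle (d + 1) N := fun w => q w.1 (c w.2)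
    have hpair : ContMDiffAt 𝓘(ℝ, ℝ × ℝ) (𝓘(ℝ, ℝ).prod (𝓡 d)) ∞
        (fun w : ℝ × ℝ => (w.1, c w.2)) (t₀, 0) :=
      (contDiffAt_fst.contMDiffAt).prodMk
        (ContMDiffAt.comp (t₀, (0 : ℝ)) hc contDiffAt_snd.contMDiffAt)
    have hQ : ContMDiffAt 𝓘(ℝ, ℝ × ℝ) (cotModel (d + 1)) ∞ Q (t₀, 0) :=
      ContMDiffAt.comp (t₀, (0 : ℝ)) (hqs t₀ ht₀ (c 0) hy) hpair
    have hop : IsOpen {q : CotangentBundle (d + 1) N | q.proj ∈ φ.source} :=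
      φ.open_source.preimage contMDiff_cotangent_proj.continuous
    have hZ : ContDiffAt ℝ ∞ (fun w => coords φ (Q w)) (t₀, 0) :=
      (ContMDiffAt.comp (t₀, (0 : ℝ)) (hφ.contMDiffOn_coords.contMDiffAt
        (hop.mem_nhds hsrc)) hQ).contDiffAt
    have hX : ContDiffAt ℝ ∞ (fun w => φ (Q w).proj) (t₀, 0) := hZ.fst
    have hP : ContDiffAt ℝ ∞ (fun w => momentum φ (Q w)) (t₀, 0) := hZ.snd
    set X : ℝ × ℝ → Euc (d + 1) := fun w => φ (Q w).proj
    set P : ℝ × ℝ → Fin (d + 1) → ℝ := fun w => momentum φ (Q w)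
    have hdX : ∀ᶠ w in 𝓝 (t₀, (0 : ℝ)), DifferentiableAt ℝ X w :=
      ((hX.of_le (by simp : (1 : ℕ∞ω) ≤ ∞)).eventually (by simp)).mono fun w hw =>
        hw.differentiableAt (by simp)
    have hdP : DifferentiableAt ℝ P (t₀, 0) := hP.differentiableAt (by simp)
    have hmem : ∀ᶠ w in 𝓝 (t₀, (0 : ℝ)), w.1 ∈ J ∧ c w.2 ∈ O ∧ (Q w).proj ∈ φ.source := by
      have h1 := hpair.continuousAt.eventually
        ((hq.isOpen_time.prod hq.isOpen_part).mem_nhds (show (t₀, c 0) ∈ J ×ˢ O from ⟨ht₀, hy⟩))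
      have h2 := hQ.continuousAt.eventually (hop.mem_nhds hsrc)
      filter_upwards [h1, h2] with w hw hw'
      exact ⟨hw.1, hw.2, hw'⟩
    have hflow : ∀ w : ℝ × ℝ, w.1 ∈ J → c w.2 ∈ O → (Q w).proj ∈ φ.source →
        HasDerivAt (fun t => X (t, w.2)) (WithLp.toLp 2 (modV H φ (X w) (P w))) w.1 ∧
        HasDerivAt (fun t => P (t, w.2)) (modTheta H φ (X w) (P w)) w.1 := fun w h1 h2 h3 => by
      have h := hasDerivAt_coords (hq.trajectory _ h2) h1 hφ h3
      exact ⟨h.fst, h.snd⟩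
    have hline : ∀ w : ℝ × ℝ, HasDerivAt (fun t : ℝ => (t, w.2)) ((1 : ℝ), (0 : ℝ)) w.1 :=
      fun w => (hasDerivAt_id _).prodMk (hasDerivAt_const _ _)
    have hXt : ∀ w : ℝ × ℝ, DifferentiableAt ℝ X w → w.1 ∈ J → c w.2 ∈ O →
        (Q w).proj ∈ φ.source →
        fderiv ℝ X w (1, 0) = WithLp.toLp 2 (modV H φ (X w) (P w)) := fun w h0 h1 h2 h3 =>
      (h0.hasFDerivAt.comp_hasDerivAt_of_eq w.1 (hline w) rfl).unique (hflow w h1 h2 h3).1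
    have hPt : fderiv ℝ P (t₀, 0) (1, 0) = modTheta H φ (X (t₀, 0)) (P (t₀, 0)) :=
      (hdP.hasFDerivAt.comp_hasDerivAt_of_eq t₀ (hline (t₀, 0)) rfl).unique
        (hflow (t₀, 0) ht₀ hy hsrc).2
    have hdom : ∀ w : ℝ × ℝ, w.1 ∈ J → c w.2 ∈ O → (Q w).proj ∈ φ.source →
        (X w, P w) ∈ coordDomain φ := fun w h1 h2 h3 =>
      hφ.coords_mem h3 ((hq.trajectory _ h2).2 w.1 h1).1
    have key := hasDerivAt_momentum_variation hX hP
      (by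
        filter_upwards [hmem, hdX] with w hw hw'
        rw [hXt w hw' hw.1 hw.2.1 hw.2.2]
        exact modV_dotProduct _ _ (hΩ φ hφ _ _ (hdom w hw.1 hw.2.1 hw.2.2)))
      (by
        rw [hPt, hXt _ hdX.self_of_nhds ht₀ hy hsrc, ← sub_eq_zero, modTheta_symplectic]
        have hD := hasFDerivAt_localH hH hφ (hdom (t₀, 0) ht₀ hy hsrc)
        have h1 := hD.comp (t₀, (0 : ℝ))
          (f := fun w => (X w, P w)) (hdX.self_of_nhds.hasFDerivAt.prodMk hdP.hasFDerivAt)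
        -- `H` has the value `e` on the whole family, so its derivative along the variation, the
        -- right side of `modTheta_symplectic`, vanishes.
        have h2 : HasFDerivAt ((fun z : Euc (d + 1) × (Fin (d + 1) → ℝ) => localH H φ z.1 z.2) ∘
            fun w => (X w, P w)) (0 : ℝ × ℝ →L[ℝ] ℝ) (t₀, 0) := by
          refine (hasFDerivAt_const e (t₀, (0 : ℝ))).congr_of_eventuallyEq ?_
          filter_upwards [hmem] with w hw
          exact (congrArg H (hφ.ofCoords_momentum hw.2.2)).trans (hHe _ hw.1 _ hw.2.1)
        have h3 := congrArg (fun L : ℝ × ℝ →L[ℝ] ℝ => L (0, 1)) (h1.unique h2)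
        simp only [ContinuousLinearMap.comp_apply, ContinuousLinearMap.prod_apply] at h3
        rw [fderiv_eq_dotProduct hD] at h3
        have h4 : (fderiv ℝ X (t₀, 0) (0, 1) : Fin (d + 1) → ℝ) ⬝ᵥ
            gradX H φ (X (t₀, 0)) (P (t₀, 0)) + fderiv ℝ P (t₀, 0) (0, 1) ⬝ᵥ
            gradP H φ (X (t₀, 0)) (P (t₀, 0)) = 0 := h3
        rw [h4, mul_zero, neg_zero])
    refine key.congr_of_eventuallyEq ?_
    have hmem' : ∀ᶠ t in 𝓝 t₀, ((t, (0 : ℝ)).1 ∈ J ∧ c (t, (0 : ℝ)).2 ∈ O ∧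
        (Q (t, 0)).proj ∈ φ.source) ∧ DifferentiableAt ℝ X (t, 0) :=
      (hline (t₀, 0)).continuousAt.eventually (hmem.and hdX)
    filter_upwards [hmem'] with s hs
    obtain ⟨⟨hsJ, -, hsφ⟩, hsX⟩ := hs
    change (q s (c 0)).2 (mfderiv (𝓡 d) (𝓡 (d + 1)) (displacement q s) (c 0) τ) = _
    refine (hφ.covector_apply hsφ (mfderiv (𝓡 d) (𝓡 (d + 1)) (displacement q s) (c 0) τ)).trans ?_
    have h1 := hasDerivAt_chart_curve hφ hcd (hdisp s hsJ _ hy) hsφ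
    have h2 : HasDerivAt (fun r : ℝ => X (s, r)) (fderiv ℝ X (s, 0) (0, 1)) 0 :=
      hsX.hasFDerivAt.comp_hasDerivAt_of_eq (0 : ℝ)
        ((hasDerivAt_const (0 : ℝ) s).prodMk (hasDerivAt_id (0 : ℝ))) rfl
    have h3 := h1.unique h2
    rw [← h3]
    rw [show mfderiv 𝓘(ℝ, ℝ) (𝓡 d) c 0 (1 : ℝ) = τ from hcτ]
    rfl
  have hconst : g t = g 0 := hq.isOpen_time.is_const_of_deriv_eq_zero
    hq.interval_time.isPreconnected
    (fun t ht => (hg t ht).differentiableAt.differentiableWithinAt)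
    (fun t ht => (hg t ht).deriv) ht hq.zero_mem
  change g t = 0
  rw [hconst]
  -- At `t = 0` the pairing is that of `ν • nu` with a vector tangent to the original hypersurface.
  have h1 : displacement q 0 =ᶠ[𝓝 (c 0)] ι := by
    filter_upwards [hq.isOpen_part.mem_nhds hy] with z hz
    exact congrArg (fun q => q.proj) (hq.initial z hz)
  have h2 : (mfderiv (𝓡 d) (𝓡 (d + 1)) (displacement q 0) (c 0) : Euc d →L[ℝ] Euc (d + 1)) =
      mfderiv (𝓡 d) (𝓡 (d + 1)) ι (c 0) := h1.mfderiv_eq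
  have h3 : ∀ (a b : CotangentBundle (d + 1) N), a = b →
      (a.2 : Euc (d + 1) →L[ℝ] ℝ) = (b.2 : Euc (d + 1) →L[ℝ] ℝ) := by rintro a _ rfl; rfl
  have h4 := h3 _ _ (hq.initial (c 0) hy)
  have h5 : g 0 = (ν (c 0) • nu (c 0)) (mfderiv (𝓡 d) (𝓡 (d + 1)) ι (c 0) τ) := by
    change (q 0 (c 0)).2 (mfderiv (𝓡 d) (𝓡 (d + 1)) (displacement q 0) (c 0) τ) = _
    exact (congrArg (fun L : Euc (d + 1) →L[ℝ] ℝ =>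
      L (mfderiv (𝓡 d) (𝓡 (d + 1)) (displacement q 0) (c 0) τ)) h4).trans
      (congrArg (fun L : Euc d →L[ℝ] Euc (d + 1) => (ν (c 0) • nu (c 0)) (L τ)) h2)
  rw [h5, _root_.smul_apply, (hnu.2 (c 0)).2 τ, smul_zero]

end Normality


/-! ### Existence of shifts -/

section CoordinateTrajectory

variable {n : ℕ} {M : Type u} [TopologicalSpace M] [ChartedSpace (Euc n) M]
  [IsManifold (𝓡 n) ∞ M] {φ : OpenPartialHomeomorph M (Euc n)} {H : CotangentBundle n M → ℝ}

/-- The flow is built in one chart, whereas a trajectory must satisfy the equations in all charts;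
the transformation laws bridge the gap. -/
theorem isTrajectory_of_coords (hH : ContMDiffOn (cotModel n) 𝓘(ℝ, ℝ) ∞ H {q | q.2 ≠ 0})
    (hφ : IsChart φ) {J : Set ℝ} {Z : ℝ → Euc n × (Fin n → ℝ)} (hZ : ∀ t ∈ J, Z t ∈ coordDomain φ)
    (hd : ∀ t ∈ J, HasDerivAt Z (WithLp.toLp 2 (modV H φ (Z t).1 (Z t).2),
      modTheta H φ (Z t).1 (Z t).2) t) :
    IsTrajectory (modV H) (modTheta H) J (fun t => ofCoords φ (Z t).1 (Z t).2) := by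
  refine ⟨fun t ht => ?_, fun t ht => ⟨hφ.ofCoords_ne_zero (hZ t ht), fun ψ hψ hs => ?_⟩⟩
  · have h1 := hφ.contMDiffOn_ofCoords.continuousOn.continuousAt
      ((φ.open_target.prod isOpen_univ).mem_nhds
        (show Z t ∈ φ.target ×ˢ univ from ⟨(hZ t ht).1, mem_univ _⟩))
    exact (ContinuousAt.comp (f := Z) h1 (hd t ht).continuousAt).continuousWithinAt
  · have ho : (Z t) ∈ coordOverlap φ ψ := ⟨hZ t ht, hs⟩
    have hx := (hZ t ht).1
    have hX : φ (ofCoords φ (Z t).1 (Z t).2).proj = (Z t).1 := φ.right_inv hx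
    have hmom : ∀ᶠ s in 𝓝 t, momentum ψ (ofCoords φ (Z s).1 (Z s).2) =
        changeP φ ψ (Z s).1 (Z s).2 := by
      filter_upwards [(hd t ht).continuousAt.eventually
        (((isOpen_overlap φ ψ).preimage continuous_fst).mem_nhds
          (show Z t ∈ _ from ⟨hx, hs⟩))] with s hs'
      rw [momentum_change hφ hψ (φ.map_target hs'.1) hs'.2, hφ.momentum_ofCoords hs'.1,
        show φ (ofCoords φ (Z s).1 (Z s).2).proj = (Z s).1 from φ.right_inv hs'.1]
    have h1 : HasDerivAt (fun s => changeX φ ψ (Z s).1)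
        (fderiv ℝ (changeX φ ψ) (Z t).1 (WithLp.toLp 2 (modV H φ (Z t).1 (Z t).2))) t := by
      have h0 := ((contDiffAt_changeX hφ hψ hx hs).differentiableAt (by simp)).hasFDerivAt
      exact h0.comp_hasDerivAt_of_eq t (hd t ht).fst rfl
    obtain ⟨L, hL, -⟩ := hasFDerivAt_changeP hφ hψ (Z t).2 hx hs
    have h2 := hL.comp_hasDerivAt_of_eq t (hd t ht) rfl
    have h3 := fderiv_changeP_modTheta hH hφ hψ ho
    rw [hL.fderiv] at h3
    rw [h3] at h2
    rw [hmom.self_of_nhds]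
    intro i
    constructor
    · have h4 := (EuclideanSpace.proj i : Euc n →L[ℝ] ℝ).hasFDerivAt.comp_hasDerivAt t h1
      have h5 : modV H ψ (changeX φ ψ (Z t).1) (changeP φ ψ (Z t).1 (Z t).2) i =
          fderiv ℝ (changeX φ ψ) (Z t).1 (WithLp.toLp 2 (modV H φ (Z t).1 (Z t).2)) i := by
        rw [modV_change hH hφ hψ ho, fderiv_changeX_apply]
        rfl
      exact h4.congr_deriv h5.symm
    · exact (hasDerivAt_pi.1 h2 i).congr_of_eventuallyEq (hmom.mono fun s hs => congrFun hs i)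

end CoordinateTrajectory

/-! ### Initial data of constant energy and the local shift -/

section Existence

variable {d : ℕ} {N : Type u} [TopologicalSpace N] [ChartedSpace (Euc (d + 1)) N]
  [IsManifold (𝓡 (d + 1)) ∞ N] {S : Type u} [TopologicalSpace S] [ChartedSpace (Euc d) S]
  {H : CotangentBundle (d + 1) N → ℝ}

omit [IsManifold (𝓡 (d + 1)) ∞ N] in
theorem momentum_smul (φ : OpenPartialHomeomorph N (Euc (d + 1))) (x : N) (r : ℝ)
    (A : TangentSpace (𝓡 (d + 1)) x →L[ℝ] ℝ) :
    momentum φ (⟨x, r • A⟩ : CotangentBundle (d + 1) N) = r • momentum φ ⟨x, A⟩ := rfl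

/-- The implicit function theorem for `K(u, r) = h(X u, r P u)`: at `(u₀, ν₀)`, `ν₀ ∂K/∂r` is the
sum `Σ pᵢ ∂h/∂pᵢ`, which is nonzero by `hΩ`. -/
theorem exists_energy_scaling {n m : ℕ} {h : Euc n → (Fin n → ℝ) → ℝ}
    {D : Set (Euc n × (Fin n → ℝ))} (hD : IsOpen D)
    (hh : ContDiffOn ℝ ∞ (fun z : Euc n × (Fin n → ℝ) => h z.1 z.2) D)
    {X : Euc m → Euc n} {P : Euc m → Fin n → ℝ} {u₀ : Euc m} {ν₀ : ℝ}
    (hX : ∀ᶠ u in 𝓝 u₀, ContDiffAt ℝ ∞ X u) (hP : ∀ᶠ u in 𝓝 u₀, ContDiffAt ℝ ∞ P u)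
    (hmem : (X u₀, ν₀ • P u₀) ∈ D)
    (hΩ : (ν₀ • P u₀) ⬝ᵥ (fun i => dp h i (X u₀) (ν₀ • P u₀)) ≠ 0) :
    ∃ g : Euc m → ℝ, g u₀ = ν₀ ∧ (∀ᶠ u in 𝓝 u₀, ContDiffAt ℝ ∞ g u) ∧
      ∀ᶠ u in 𝓝 u₀, h (X u) (g u • P u) = h (X u₀) (ν₀ • P u₀) := by
  let K : Euc m × ℝ → ℝ := fun w => h (X w.1) (w.2 • P w.1)
  have hinner : ∀ w : Euc m × ℝ, ContDiffAt ℝ ∞ X w.1 → ContDiffAt ℝ ∞ P w.1 →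
      ContDiffAt ℝ ∞ (fun w : Euc m × ℝ => (X w.1, w.2 • P w.1)) w := fun w h1 h2 =>
    (h1.comp w contDiffAt_fst).prodMk (contDiffAt_snd.smul (h2.comp w contDiffAt_fst))
  have hK : ∀ᶠ w in 𝓝 (u₀, ν₀), ContDiffAt ℝ ∞ K w := by
    have h1 := (hinner (u₀, ν₀) hX.self_of_nhds hP.self_of_nhds).continuousAt.eventually
      (hD.mem_nhds hmem)
    have h2 : ∀ᶠ w in 𝓝 (u₀, ν₀), ContDiffAt ℝ ∞ X w.1 ∧ ContDiffAt ℝ ∞ P w.1 :=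
      (continuousAt_fst : Filter.Tendsto Prod.fst (𝓝 (u₀, ν₀)) (𝓝 u₀)).eventually (hX.and hP)
    filter_upwards [h1, h2] with w hw hw'
    exact (hh.contDiffAt (hD.mem_nhds hw)).comp w (hinner w hw'.1 hw'.2)
  have hd := ((hh.contDiffAt (hD.mem_nhds hmem)).differentiableAt (by simp)).hasFDerivAt
  have hKd : HasDerivAt (fun s => K (u₀, s)) (P u₀ ⬝ᵥ (fun i => dp h i (X u₀) (ν₀ • P u₀))) ν₀ := by
    have h1 := hd.comp_hasDerivAt_of_eq ν₀ ((hasDerivAt_const ν₀ (X u₀)).prodMk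
      ((hasDerivAt_id ν₀).smul_const (P u₀))) rfl
    rw [fderiv_eq_dotProduct hd, one_smul] at h1
    refine h1.congr_deriv ?_
    change (0 : Fin n → ℝ) ⬝ᵥ _ + _ = _
    rw [zero_dotProduct, zero_add]
  have hne : P u₀ ⬝ᵥ (fun i => dp h i (X u₀) (ν₀ • P u₀)) ≠ 0 := fun h0 => hΩ (by
    rw [smul_dotProduct, h0, smul_zero])
  have if₂ : (fderiv ℝ K (u₀, ν₀) ∘L .inr ℝ (Euc m) ℝ).IsInvertible := by
    rw [(hKd.hasFDerivAt_equiv hne).fderiv_comp_inr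
      (hK.self_of_nhds.differentiableAt (by simp))]
    exact ⟨_, rfl⟩
  exact ⟨_, hK.self_of_nhds.implicitFunction_apply_self (by simp) if₂,
    ContDiffAt.eventually_contDiffAt_implicitFunction hK (by simp) if₂,
    hK.self_of_nhds.eventually_apply_implicitFunction (by simp) if₂⟩

theorem exists_normal_shift [IsManifold (𝓡 d) ∞ S]
    (hH : ContMDiffOn (cotModel (d + 1)) 𝓘(ℝ, ℝ) ∞ H {q | q.2 ≠ 0})
    (hΩ : ∀ φ : OpenPartialHomeomorph N (Euc (d + 1)), IsChart φ →
      ∀ x p, (x, p) ∈ coordDomain φ → Omega H φ x p ≠ 0)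
    {ι : S → N} {nu : ∀ y, TangentSpace (𝓡 (d + 1)) (ι y) →L[ℝ] ℝ} (hι : IsHypersurface (d := d) ι)
    (hnu : IsNormalCovectorField ι nu) (y₀ : S) {ν₀ : ℝ} (hν₀ : ν₀ ≠ 0) :
    ∃ (O : Set S) (ν : S → ℝ), IsOpen O ∧ y₀ ∈ O ∧ ContMDiffOn (𝓡 d) 𝓘(ℝ, ℝ) ∞ ν O ∧ ν y₀ = ν₀ ∧
      (∀ y ∈ O, H ⟨ι y, ν y • nu y⟩ = H ⟨ι y₀, ν₀ • nu y₀⟩) ∧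
      ∃ ε : ℝ, 0 < ε ∧ ∃ q : ℝ → S → CotangentBundle (d + 1) N,
        IsShift (IsTrajectory (modV H) (modTheta H)) ι nu ν (Ioo (-ε) ε) O q ∧
        ∀ t ∈ Ioo (-ε) ε, ∀ y ∈ O,
          Function.Injective (mfderiv (𝓡 d) (𝓡 (d + 1)) (displacement q t) y) := by
  have hχ := isChart_chartAt (n := d) y₀
  have hφ := isChart_chartAt (n := d + 1) (ι y₀)
  set χ := chartAt (Euc d) y₀
  set φ := chartAt (Euc (d + 1)) (ι y₀)
  have hy₀ : y₀ ∈ χ.source := mem_chart_source _ _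
  have hιy₀ : ι y₀ ∈ φ.source := mem_chart_source _ _
  set u₀ := χ y₀
  have hu₀ : u₀ ∈ χ.target := χ.map_source hy₀
  have hsu₀ : χ.symm u₀ = y₀ := χ.left_inv hy₀
  let A : S → CotangentBundle (d + 1) N := fun y => ⟨ι y, nu y⟩
  let X : Euc d → Euc (d + 1) := fun u => φ (ι (χ.symm u))
  let P : Euc d → Fin (d + 1) → ℝ := fun u => momentum φ (A (χ.symm u))
  -- the part of the hypersurface covered by the charts
  have hU₀ : ∀ᶠ u in 𝓝 u₀, u ∈ χ.target ∧ ι (χ.symm u) ∈ φ.source := by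
    refine Filter.Eventually.and (χ.open_target.mem_nhds hu₀) ?_
    have h1 : ContinuousAt (fun u => ι (χ.symm u)) u₀ :=
      hι.1.continuous.continuousAt.comp (hχ.contMDiffAt_symm hu₀).continuousAt
    refine h1.eventually (φ.open_source.mem_nhds ?_)
    change ι (χ.symm u₀) ∈ φ.source
    rw [hsu₀]; exact hιy₀
  have hop : IsOpen {q : CotangentBundle (d + 1) N | q.proj ∈ φ.source} :=
    φ.open_source.preimage contMDiff_cotangent_proj.continuous
  have hXP : ∀ᶠ u in 𝓝 u₀, ContDiffAt ℝ ∞ (fun u => (X u, P u)) u := by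
    filter_upwards [hU₀] with u hu
    have h1 := (hφ.contMDiffOn_coords.contMDiffAt (hop.mem_nhds
      (show A (χ.symm u) ∈ {q : CotangentBundle (d + 1) N | q.proj ∈ φ.source} from hu.2)))
    exact (ContMDiffAt.comp u h1 (hnu.1.contMDiffAt.comp u (hχ.contMDiffAt_symm hu.1))).contDiffAt
  have hdom : ∀ (u : Euc d) (r : ℝ), u ∈ χ.target → ι (χ.symm u) ∈ φ.source → r ≠ 0 →
      (X u, r • P u) ∈ coordDomain φ := by
    intro u r hu hu' hr
    have h1 := hφ.coords_mem (q := A (χ.symm u)) hu' (hnu.2 _).1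
    exact ⟨h1.1, smul_ne_zero hr h1.2⟩
  have hdom₀ : (X u₀, ν₀ • P u₀) ∈ coordDomain φ :=
    hdom u₀ ν₀ hu₀ hU₀.self_of_nhds.2 hν₀
  obtain ⟨g, hg₀, hgs, hgH⟩ := exists_energy_scaling (isOpen_coordDomain φ)
    (contDiffOn_localH hH hφ) (hXP.mono fun u hu => hu.fst) (hXP.mono fun u hu => hu.snd)
    hdom₀ (hΩ φ hφ _ _ hdom₀)
  have hg0 : ∀ᶠ u in 𝓝 u₀, g u ≠ 0 :=
    hgs.self_of_nhds.continuousAt.eventually_ne (by rw [hg₀]; exact hν₀)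
  let z : Euc d → Euc (d + 1) × (Fin (d + 1) → ℝ) := fun u => (X u, g u • P u)
  have hzs : ∀ᶠ u in 𝓝 u₀, ContDiffAt ℝ ∞ z u := by
    filter_upwards [hXP, hgs] with u hu hu'
    exact hu.fst.prodMk (hu'.smul hu.snd)
  have hz₀ : z u₀ ∈ coordDomain φ := by
    change (X u₀, g u₀ • P u₀) ∈ _
    rw [hg₀]; exact hdom₀
  -- the flow
  have hY : ContDiffOn ℝ ∞ (fun w : Euc (d + 1) × (Fin (d + 1) → ℝ) =>
      ((WithLp.toLp 2 (modV H φ w.1 w.2), modTheta H φ w.1 w.2) :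
        Euc (d + 1) × (Fin (d + 1) → ℝ))) (coordDomain φ) :=
    ((EuclideanSpace.equiv (Fin (d + 1)) ℝ).symm.contDiff.comp_contDiffOn
      (smoothComponents_modV hH hΩ φ hφ)).prodMk (smoothComponents_modTheta hH hΩ φ hφ)
  obtain ⟨ε₁, hε₁, W, hW, hz₀W, F, hF, hF0, hFd⟩ :=
    exists_smooth_local_flow_of_contDiffOn (isOpen_coordDomain φ) hY hz₀
  have hzW : ∀ᶠ u in 𝓝 u₀, z u ∈ W := hzs.self_of_nhds.continuousAt.eventually (hW.mem_nhds hz₀W)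
  have hFs : ∀ t ∈ Ioo (-ε₁) ε₁, ∀ w ∈ W, ContDiffAt ℝ ∞ F (t, w) := fun t ht w hw =>
    hF.contDiffAt ((isOpen_Ioo.prod hW).mem_nhds ⟨ht, hw⟩)
  have hpairs : ∀ (t : ℝ) (u : Euc d), ContDiffAt ℝ ∞ z u →
      ContDiffAt ℝ ∞ (fun w : ℝ × Euc d => (w.1, z w.2)) (t, u) := fun t u hu =>
    contDiffAt_fst.prodMk (ContDiffAt.comp (t, u) (f := Prod.snd) hu contDiffAt_snd)
  -- the displaced hypersurfaces in the charts
  let E : ℝ × Euc d → Euc (d + 1) := fun w => (F (w.1, z w.2)).1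
  have hEs : ∀ t ∈ Ioo (-ε₁) ε₁, ∀ u, ContDiffAt ℝ ∞ z u → z u ∈ W → ContDiffAt ℝ ∞ E (t, u) :=
    fun t ht u hu hu' => (ContDiffAt.comp (t, u) (hFs t ht _ hu') (hpairs t u hu)).fst
  have h0ε₁ : (0 : ℝ) ∈ Ioo (-ε₁) ε₁ := by simpa using hε₁
  have hE0 := hEs 0 h0ε₁ u₀ hzs.self_of_nhds hz₀W
  have hXinj : Function.Injective (fderiv ℝ X u₀) := by
    have hm1 := hφ.mdifferentiable.mdifferentiableAt hU₀.self_of_nhds.2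
    have hm2 : MDifferentiableAt (𝓡 d) (𝓡 (d + 1)) ι (χ.symm u₀) :=
      hι.1.mdifferentiableAt (by simp)
    have hm3 := hχ.mdifferentiable.mdifferentiableAt_symm hu₀
    have h1 := (hm1.hasMFDerivAt.comp _ hm2.hasMFDerivAt).comp u₀ hm3.hasMFDerivAt
    have h2 : HasFDerivAt (𝕜 := ℝ) (E := Euc d) (F := Euc (d + 1)) X _ u₀ := h1.hasFDerivAt
    rw [h2.fderiv]
    exact ((hφ.mdifferentiable.mfderiv_injective hU₀.self_of_nhds.2).comp (hι.2 _)).comp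
      (hχ.mdifferentiable.symm.mfderiv_injective hu₀)
  -- At time `0` the displacement in the charts is `X`, an immersion at `u₀`. Injective linear maps
  -- form an open set here, so nearby times and points inherit injectivity.
  have hEinj : ∀ᶠ w in 𝓝 ((0 : ℝ), u₀),
      Function.Injective (fderiv ℝ E w ∘L .inr ℝ ℝ (Euc d)) := by
    have h1 : ContinuousAt (fun w => fderiv ℝ E w ∘L .inr ℝ ℝ (Euc d)) ((0 : ℝ), u₀) :=
      (hE0.fderiv_right (m := ∞) (by simp)).continuousAt.clm_comp continuousAt_const
    refine h1.eventually (ContinuousLinearMap.isOpen_injective.mem_nhds ?_)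
    have h2 : HasFDerivAt (fun u => E (0, u)) (fderiv ℝ X u₀) u₀ := by
      refine (hXP.self_of_nhds.fst.differentiableAt (by simp)).hasFDerivAt.congr_of_eventuallyEq ?_
      filter_upwards [hzW] with u hu
      exact congrArg Prod.fst (hF0 _ hu)
    change Function.Injective (fderiv ℝ E (0, u₀) ∘L .inr ℝ ℝ (Euc d))
    rw [h2.fderiv_comp_inr (hE0.differentiableAt (by simp))]
    exact hXinj
  -- the neighbourhood and the time interval
  obtain ⟨T, hT, G₁, hG₁, hTG⟩ := mem_nhds_prod_iff.1 hEinj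
  obtain ⟨ε₂, hε₂, hTε⟩ := Metric.mem_nhds_iff.1 hT
  obtain ⟨G, hGsub, hG, hu₀G⟩ := mem_nhds_iff.1
    (hU₀.and (hgs.and (hgH.and (hg0.and (hzs.and (hzW.and hG₁))))))
  set ε := min ε₁ ε₂
  have hε : 0 < ε := lt_min hε₁ hε₂
  have hlt : ∀ t ∈ Ioo (-ε) ε, t ∈ Ioo (-ε₁) ε₁ ∧ t ∈ T := fun t ht => by
    have ht' := lt_min_iff.1 (abs_lt.2 ht)
    exact ⟨abs_lt.1 ht'.1, hTε (by simpa [Real.dist_eq] using ht'.2)⟩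
  let O : Set S := χ.source ∩ χ ⁻¹' G
  have hO : IsOpen O := χ.isOpen_inter_preimage hG
  let ν : S → ℝ := fun y => g (χ y)
  let q : ℝ → S → CotangentBundle (d + 1) N := fun t y =>
    ofCoords φ (F (t, z (χ y))).1 (F (t, z (χ y))).2
  have hgood : ∀ y ∈ O, _ := fun y hy => hGsub hy.2
  have hXA : ∀ y ∈ O, X (χ y) = φ (ι y) ∧ P (χ y) = momentum φ (A y) := fun y hy => by
    have : χ.symm (χ y) = y := χ.left_inv hy.1
    constructor
    · exact congrArg (fun y => φ (ι y)) this
    · exact congrArg (fun y => momentum φ (A y)) this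
  have hιO : ∀ y ∈ O, ι y ∈ φ.source := fun y hy => by
    have h := (hgood y hy).1.2
    rwa [χ.left_inv hy.1] at h
  have hinit : ∀ y ∈ O, ofCoords φ (X (χ y)) (g (χ y) • P (χ y)) = ⟨ι y, ν y • nu y⟩ := by
    intro y hy
    rw [(hXA y hy).1, (hXA y hy).2, ← momentum_smul]
    exact hφ.ofCoords_momentum (q := ⟨ι y, ν y • nu y⟩) (hιO y hy)
  have hFmem : ∀ t ∈ Ioo (-ε) ε, ∀ y ∈ O, F (t, z (χ y)) ∈ coordDomain φ := fun t ht y hy =>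
    (hFd _ (hgood y hy).2.2.2.2.2.1 t (hlt t ht).1).1
  refine ⟨O, ν, hO, ⟨hy₀, hu₀G⟩, ?_, hg₀, ?_, ε, hε, q, ?_, ?_⟩
  · intro y hy
    exact (ContMDiffAt.comp y (hgood y hy).2.1.contMDiffAt
      (hχ.contMDiffAt hy.1)).contMDiffWithinAt
  · intro y hy
    rw [← hinit y hy]
    have h1 := (hgood y hy).2.2.1
    have h2 := hinit y₀ ⟨hy₀, hu₀G⟩
    have h3 : ν y₀ = ν₀ := hg₀
    rw [h3] at h2
    change g u₀ = ν₀ at hg₀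
    rw [hg₀] at h2
    rw [← h2]
    exact h1
  · refine ⟨isOpen_Ioo, ordConnected_Ioo, by simpa using hε, hO, ?_, ?_, ?_⟩
    · rintro ⟨t, y⟩ ⟨ht, hy⟩
      refine ContMDiffAt.contMDiffWithinAt ?_
      have h1 := hφ.contMDiffOn_ofCoords.contMDiffAt
        ((φ.open_target.prod isOpen_univ).mem_nhds
          (show F (t, z (χ y)) ∈ φ.target ×ˢ univ from ⟨(hFmem t ht y hy).1, mem_univ _⟩))
      have h2 : ContMDiffAt (𝓘(ℝ, ℝ).prod (𝓡 d)) 𝓘(ℝ, ℝ × Euc d) ∞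
          (fun w : ℝ × S => (w.1, χ w.2)) (t, y) :=
        contMDiffAt_fst.prodMk_space ((hχ.contMDiffAt hy.1).comp (t, y) contMDiffAt_snd)
      have h3 : ContDiffAt ℝ ∞ (fun w : ℝ × Euc d => F (w.1, z w.2)) (t, χ y) :=
        ContDiffAt.comp (t, χ y) (hFs t (hlt t ht).1 _ (hgood y hy).2.2.2.2.2.1)
          (hpairs t _ (hgood y hy).2.2.2.2.1)
      exact ContMDiffAt.comp (t, y) h1 (ContMDiffAt.comp (t, y) h3.contMDiffAt h2)
    · intro y hy
      rw [← hinit y hy]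
      change ofCoords φ (F (0, z (χ y))).1 (F (0, z (χ y))).2 = _
      rw [hF0 _ (hgood y hy).2.2.2.2.2.1]
    · intro y hy
      exact isTrajectory_of_coords hH hφ (fun t ht => hFmem t ht y hy) fun t ht =>
        (hFd _ (hgood y hy).2.2.2.2.2.1 t (hlt t ht).1).2
  -- The displacement map is `φ.symm ∘ E(t, ·) ∘ χ`, and the differential of each factor is
  -- injective.
  · intro t ht y hy
    have hgy := hgood y hy
    have hEt := (hEs t (hlt t ht).1 _ hgy.2.2.2.2.1 hgy.2.2.2.2.2.1).differentiableAt (by simp)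
    have hEd : HasFDerivAt (fun u => E (t, u)) (fderiv ℝ E (t, χ y) ∘L .inr ℝ ℝ (Euc d)) (χ y) :=
      hEt.hasFDerivAt.comp (χ y) (hasFDerivAt_prodMk_right t (χ y))
    have hm1 := hφ.mdifferentiable.mdifferentiableAt_symm (hFmem t ht y hy).1
    have hm3 := hχ.mdifferentiable.mdifferentiableAt hy.1
    have h1 := (hm1.hasMFDerivAt.comp (f := fun u => E (t, u)) (χ y) hEd.hasMFDerivAt).comp y
      hm3.hasMFDerivAt
    have h2 : HasMFDerivAt (𝓡 d) (𝓡 (d + 1)) (displacement q t) y _ := h1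
    rw [h2.mfderiv]
    exact ((hφ.mdifferentiable.symm.mfderiv_injective (hFmem t ht y hy).1).comp
      (hTG (mk_mem_prod (hlt t ht).2 hgy.2.2.2.2.2.2))).comp
      (hχ.mdifferentiable.mfderiv_injective hy.1)

/-- Normality has to hold for every shift of every open part of `O`, not just the one constructed.
It follows from constancy of the energy on `O` alone. -/
theorem admitsNormalShift_modified
    (hH : ContMDiffOn (cotModel (d + 1)) 𝓘(ℝ, ℝ) ∞ H {q | q.2 ≠ 0})
    (hΩ : ∀ φ : OpenPartialHomeomorph N (Euc (d + 1)), IsChart φ →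
      ∀ x p, (x, p) ∈ coordDomain φ → Omega H φ x p ≠ 0) :
    AdmitsNormalShift (IsTrajectory (modV H) (modTheta H)) := by
  intro S _ _ _ ι nu hι hnu y₀ ν₀ hν₀
  obtain ⟨O, ν, hO, hy₀, hν, hνy₀, hE, hq⟩ := exists_normal_shift hH hΩ hι hnu y₀ hν₀
  exact ⟨O, ν, hO, hy₀, hν, hνy₀, hq, fun J O' q hO' hq =>
    shiftIsNormal hH hΩ hnu (fun y hy => hE y (hO' hy)) hq⟩

end Existence

end NormalShift

end

theorem theorem14p1 {d : ℕ} {M : Type*} [TopologicalSpace M] [T2Space M]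
    [ChartedSpace (Euc (d + 1)) M] [IsManifold (𝓡 (d + 1)) ∞ M]
    (H : NormalShift.CotangentBundle (d + 1) M → ℝ)
    (hH : ContMDiffOn (NormalShift.cotModel (d + 1)) 𝓘(ℝ, ℝ) ∞ H {q | q.2 ≠ 0})
    (hΩ : ∀ φ : OpenPartialHomeomorph M (Euc (d + 1)), NormalShift.IsChart φ →
      ∀ x p, (x, p) ∈ NormalShift.coordDomain φ → NormalShift.Omega H φ x p ≠ 0) :
    (∀ Γ : NormalShift.SymmetricExtendedConnection (d + 1) M,
      NormalShift.IsExtendedVectorField (NormalShift.modV H) ∧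
      NormalShift.IsExtendedCovectorField (NormalShift.modQ H Γ) ∧
      NormalShift.AdmitsNormalShift
        (NormalShift.IsCovTrajectory Γ (NormalShift.modV H) (NormalShift.modQ H Γ))) ∧
    (NormalShift.IsNewtonianSystem (NormalShift.modV H) (NormalShift.modTheta H) ∧
      NormalShift.AdmitsNormalShift
        (NormalShift.IsTrajectory (NormalShift.modV H) (NormalShift.modTheta H))) := by
  have hshift := NormalShift.admitsNormalShift_modified hH hΩ
  refine ⟨fun Γ => ⟨NormalShift.isExtendedVectorField_modV hH hΩ,
    NormalShift.isExtendedCovectorField_modQ hH hΩ Γ, ?_⟩,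
    NormalShift.isNewtonianSystem_modified hH hΩ, hshift⟩
  rw [NormalShift.isCovTrajectory_eq_isTrajectory]
  exact hshift
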